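/- Let $d \ge 3$ be odd, $d = 2c+1$, and place qubits on the vertices $(x,y)\in[-c,c]^2$ of the $d\times d$ square grid. The Floquet Bacon--Shor code (with one gauge defect) is the dynamical code that measures the following sets $\mathbf M_t$, $t\ge 1$, of commuting Pauli operators, periodically in $t$ with period $4$: - $t \equiv 1 \pmod 4$: $XX$ on all horizontal edges, except the edges $\{(0,y),(1,y)\}$ with $y\neq 0$; - $t \equiv 2 \pmod 4$: $ZZ$ on all vertical edges, except the edges $\{(x,0),(x,1)\}$ with $x\neq 0$; - $t \equiv 3 \pmod 4$: $XX$ on all horizontal edges, except the edges $\{(-1,y),(0,y)\}$ with $y\neq 0$; - $t \equiv 0 \pmod 4$: $ZZ$ on all vertical edges, except the edges $\{(x,-1),(x,0)\}$ with $x\neq 0$. Pauli operators are taken up to phase. Put $\mathsf{ISG}(0)=\{\mathbf 1\}$, and let $\mathsf{ISG}(t)$ be generated by $\mathbf M_t$ and those elements of $\mathsf{ISG}(t-1)$ that commute with all of $\mathbf M_t$. A time $t$ is steady if $\operatorname{rank}\mathsf{ISG}(t')=\operatorname{rank}\mathsf{ISG}(t)$ for all $t'>t$. The number of encoded qubits is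 $d^2-\lim_{t\to\infty}\operatorname{rank}\mathsf{ISG}(t)$; the static ones among them are the logical qubits of the parent subsystem code, whose gauge group is generated by all measured operators, and the others are dynamical. A spacetime error $E=(E_t)_{t\ge0}$ consists of Pauli operators, finitely many of them nontrivial, $E_t$ being inserted immediately after the measurements at time $t$; its weight is the number of its nonidentity tensor factors. It is in the steady stage if it is supported on times $\ge t_0$ for some steady $t_0$. An ancestry of $S\in\mathsf{ISG}(t)$ is a sequence $P_0=\mathbf 1,P_1,\dots,P_t=S$ such that, for each $1\le j\le t$, $P_{j-1}$ commutes with $\mathbf M_j$ and $P_jP_{j-1}^{-1}\in\langle\mathbf M_j\rangle$. A detector at time $t+1$ is an element of $\langle \mathbf M_{t+1}\rangle\cap\mathsf{ISG}(t)$; $E$ triggers it if, for some ancestry $(P_j)$ of it, the number of $j\le t$ for which $E_j$ anticommutes with $P_j$ is odd. $E$ is undetectable if it triggers no detector at any time. $E$ is benign if it is a finite product of vacuous errors (an element of $\mathbf M_t$ inserted at time $t$, $t\ge1$) and sandwiching errors (one Pauli operator that commutes with all of $\mathbf M_{t+1}$, inserted both at time $t$ and at time $t+1$). The spacetime code distance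 is the minimal weight of a nonbenign undetectable error in the steady stage. Then the Floquet Bacon--Shor code on the $d\times d$ grid encodes two logical qubits, one static and one dynamical, and its spacetime code distance equals $d-1=2c$. -/

import Mathlib

/-- Pauli operators on qubits labelled by `V`, up to phase: `P.1 v` and `P.2 v` are the exponents of
`X` and `Z` on the qubit `v`. Products of operators are sums of vectors, the identity is `0`. -/
abbrev Pauli (V : Type) : Type := (V → ZMod 2) × (V → ZMod 2)

namespace Pauli

variable {V : Type} [Fintype V]

/-- The commutation value: `0` if `P` and `Q` commute, `1` if they anticommute. -/
def comm (P Q : Pauli V) : ZMod 2 := ∑ v, (P.1 v * Q.2 v + P.2 v * Q.1 v)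

/-- The operators that commute with every element of `S`. -/
def commutant (S : Set (Pauli V)) : Submodule (ZMod 2) (Pauli V) where
  carrier := {P | ∀ Q ∈ S, comm P Q = 0}
  zero_mem' := by intro Q _; simp [comm]
  add_mem' := by
    intro P P' hP hP' Q hQ
    have h := congrArg₂ (· + ·) (hP Q hQ) (hP' Q hQ)
    simp only [comm, ← Finset.sum_add_distrib, add_zero] at h
    simp only [comm, Prod.fst_add, Prod.snd_add, Pi.add_apply]
    rw [← h]
    exact Finset.sum_congr rfl fun v _ => by ring
  smul_mem' := by
    intro a P hP Q hQ
    have h := congrArg (a * ·) (hP Q hQ)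
    simp only [comm, Finset.mul_sum, mul_zero] at h
    simp only [comm, Prod.smul_fst, Prod.smul_snd, Pi.smul_apply, smul_eq_mul]
    rw [← h]
    exact Finset.sum_congr rfl fun v _ => by ring

/-- The number of qubits on which `P` is not the identity. -/
noncomputable def weight (P : Pauli V) : ℕ := {v : V | P.1 v ≠ 0 ∨ P.2 v ≠ 0}.ncard

/-- The operator `X` on the qubit `v`. -/
def X [DecidableEq V] (v : V) : Pauli V := (Pi.single v 1, 0)

/-- The operator `Z` on the qubit `v`. -/
def Z [DecidableEq V] (v : V) : Pauli V := (0, Pi.single v 1)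

end Pauli

/-- A dynamical code: for every `t ≥ 1` a set `meas t` of pairwise commuting Pauli operators, which
are measured at time `t`. The value `meas 0` is never used: nothing is measured at time `0`. -/
structure DynamicalCode (V : Type) [Fintype V] where
  meas : ℕ → Set (Pauli V)
  comm_meas : ∀ t, 1 ≤ t → ∀ A ∈ meas t, ∀ B ∈ meas t, Pauli.comm A B = 0

/-- A spacetime Pauli error up to phase; the component `E t` is inserted immediately after the
measurements of time `t`. -/
abbrev SpacetimeError (V : Type) : Type := ℕ →₀ Pauli V

/-- The number of nonidentity tensor factors of a spacetime error. -/
noncomputable def SpacetimeError.weight {V : Type} [Fintype V] (E : SpacetimeError V) : ℕ :=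
  E.sum fun _ P => P.weight

namespace DynamicalCode

variable {V : Type} [Fintype V] (D : DynamicalCode V)

/-- The instantaneous stabilizer group after the measurements of time `t`, up to signs, starting
from the maximally mixed state. A round of measurements keeps the stabilizers that commute with
all measured operators, and adjoins the measured operators. -/
def ISG : ℕ → Submodule (ZMod 2) (Pauli V)
  | 0 => ⊥
  | t + 1 => Submodule.span (ZMod 2) (D.meas (t + 1)) ⊔ (ISG t ⊓ Pauli.commutant (D.meas (t + 1)))

/-- The rank of the stabilizer group at time `t`. -/
noncomputable def rank (t : ℕ) : ℕ := Module.finrank (ZMod 2) (D.ISG t)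

/-- Time `t` is in the steady stage. -/
def IsSteady (t : ℕ) : Prop := ∀ t', t < t' → D.rank t = D.rank t'

/-- The error `E` is supported on a time interval that starts in the steady stage. -/
def InSteadyStage (E : SpacetimeError V) : Prop :=
  ∃ t₀, D.IsSteady t₀ ∧ ∀ t, t < t₀ → E t = 0

/-- `P` records how the eigenvalue of the stabilizer `S` of time `t` is inferred from earlier
measurement outcomes: `P j` is the stabilizer of time `j ≤ t` from which the value of `S` derives.
Going back from time `j + 1` to time `j` one strips off a product of operators measured at time
`j + 1`, so that what remains is a stabilizer of time `j` that those measurements do not disturb.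
With several measurements per round the record is unique only up to records of
products of outcomes that were deterministic already, that is, up to earlier detectors. -/
def IsAncestry (t : ℕ) (S : Pauli V) (P : ℕ → Pauli V) : Prop :=
  P 0 = 0 ∧ P t = S ∧ ∀ j, j < t →
    P j ∈ Pauli.commutant (D.meas (j + 1)) ∧
    P (j + 1) - P j ∈ Submodule.span (ZMod 2) (D.meas (j + 1))

/-- A detector at time `t + 1` is a product `m` of operators measured at that time which is a
stabilizer of time `t`, so that its measured value can be compared with the value inferred
from earlier outcomes. -/
def IsDetector (t : ℕ) (m : Pauli V) : Prop :=
  m ∈ Submodule.span (ZMod 2) (D.meas (t + 1)) ∧ m ∈ D.ISG t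

/-- The error `E` flips the stabilizer of time `t` that has the record `P`, relative to the value
inferred from the measurement outcomes: an odd number of the components of `E` up to
time `t` anticommute with the corresponding `P j`. -/
def Triggers (E : SpacetimeError V) (t : ℕ) (P : ℕ → Pauli V) : Prop :=
  ∑ j ∈ Finset.range (t + 1), Pauli.comm (E j) (P j) = 1

/-- `E` triggers no detector at any time. -/
def Undetectable (E : SpacetimeError V) : Prop :=
  ∀ t m P, D.IsDetector t m → D.IsAncestry t m P → ¬ Triggers E t P

/-- A vacuous error: an operator measured at a time `t ≥ 1`, inserted at time `t`. -/
def IsVacuous (E : SpacetimeError V) : Prop :=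
  ∃ t, ∃ m ∈ D.meas (t + 1), E = Finsupp.single (t + 1) m

/-- A sandwiching error: the same operator inserted at times `t` and `t + 1`, commuting with every
operator measured at time `t + 1`. -/
def IsSandwiching (E : SpacetimeError V) : Prop :=
  ∃ t, ∃ P ∈ Pauli.commutant (D.meas (t + 1)),
    E = Finsupp.single t P + Finsupp.single (t + 1) P

/-- Benign errors: finite products of vacuous and sandwiching errors. -/
def IsBenign (E : SpacetimeError V) : Prop :=
  E ∈ Submodule.span (ZMod 2) {F : SpacetimeError V | D.IsVacuous F ∨ D.IsSandwiching F}

/-- The spacetime code distance is `δ`: the least weight of a nonbenign undetectable error in the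
steady stage. -/
def HasDistance (δ : ℕ) : Prop :=
  IsLeast {w : ℕ | ∃ E : SpacetimeError V,
    D.InSteadyStage E ∧ D.Undetectable E ∧ ¬ D.IsBenign E ∧ E.weight = w} δ

/-- The code encodes `k` qubits: the rank of the stabilizer group tends to `n - k`. -/
def Encodes (k : ℕ) : Prop := ∃ T, ∀ t, T ≤ t → D.rank t + k = Fintype.card V

/-- All operators that are measured at some time. -/
def allMeas : Set (Pauli V) := {P | ∃ t, 1 ≤ t ∧ P ∈ D.meas t}

/-- The parent subsystem code, whose gauge group is generated by all measured operators, encodes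
`s` qubits: the operators commuting with the gauge group, modulo the stabilizers (the
centre of the gauge group), have dimension `2 * s`. -/
def EncodesStatic (s : ℕ) : Prop :=
  Module.finrank (ZMod 2) (Pauli.commutant D.allMeas) =
    Module.finrank (ZMod 2)
      ↥(Submodule.span (ZMod 2) D.allMeas ⊓ Pauli.commutant D.allMeas) + 2 * s

/-- The code encodes `s` static qubits, those of its parent subsystem code, and `m` further,
dynamical qubits. -/
def EncodesStaticDynamical (s m : ℕ) : Prop := D.EncodesStatic s ∧ D.Encodes (s + m)

end DynamicalCode

namespace FloquetBaconShor

/-- `XX` on the horizontal edges `(x, y) - (x + 1, y)` of the `d × d` grid, where in every row other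
than the middle row `y = d / 2` the edge with `x = g` is left out. -/
def horizontal (d g : ℕ) : Set (Pauli (Fin d × Fin d)) :=
  {P | ∃ x x' y : Fin d, (x' : ℕ) = (x : ℕ) + 1 ∧ ((y : ℕ) = d / 2 ∨ (x : ℕ) ≠ g) ∧
    P = Pauli.X (x, y) + Pauli.X (x', y)}

/-- `ZZ` on the vertical edges `(x, y) - (x, y + 1)` of the `d × d` grid, where in every column other
than the middle column `x = d / 2` the edge with `y = g` is left out. -/
def vertical (d g : ℕ) : Set (Pauli (Fin d × Fin d)) :=
  {P | ∃ x y y' : Fin d, (y' : ℕ) = (y : ℕ) + 1 ∧ ((x : ℕ) = d / 2 ∨ (y : ℕ) ≠ g) ∧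
    P = Pauli.Z (x, y) + Pauli.Z (x, y')}

/-- The measurement schedule of period four. In the first two rounds of a period the omitted edges
are those directly after the middle column and the middle row, in the last two rounds
those directly before. -/
def schedule (d t : ℕ) : Set (Pauli (Fin d × Fin d)) :=
  if t % 4 = 1 then horizontal d (d / 2)
  else if t % 4 = 2 then vertical d (d / 2)
  else if t % 4 = 3 then horizontal d (d / 2 - 1)
  else vertical d (d / 2 - 1)

theorem comm_horizontal (d g : ℕ) {A B : Pauli (Fin d × Fin d)}
    (hA : A ∈ horizontal d g) (hB : B ∈ horizontal d g) : Pauli.comm A B = 0 := by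
  obtain ⟨x, x', y, -, -, rfl⟩ := hA
  obtain ⟨u, u', w, -, -, rfl⟩ := hB
  simp [Pauli.comm, Pauli.X]

theorem comm_vertical (d g : ℕ) {A B : Pauli (Fin d × Fin d)}
    (hA : A ∈ vertical d g) (hB : B ∈ vertical d g) : Pauli.comm A B = 0 := by
  obtain ⟨x, y, y', -, -, rfl⟩ := hA
  obtain ⟨u, w, w', -, -, rfl⟩ := hB
  simp [Pauli.comm, Pauli.Z]

/-- The Floquet Bacon--Shor code with one gauge defect, at the centre of the `d × d` grid. -/
def code (d : ℕ) : DynamicalCode (Fin d × Fin d) where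
  meas := schedule d
  comm_meas := by
    intro t _ A hA B hB
    unfold schedule at hA hB
    split_ifs at hA hB
    · exact comm_horizontal d _ hA hB
    · exact comm_vertical d _ hA hB
    · exact comm_horizontal d _ hA hB
    · exact comm_vertical d _ hA hB

end FloquetBaconShor

/-! Every measured operator is purely X or purely Z, so the two types decouple, and exchanging
coordinates together with X and Z carries horizontal rounds to vertical ones. A horizontal round
generates the X operators that are even on each component of the cut rows (`rowEven`); it leaves
undisturbed exactly the Z operators that are constant on these components (`rowConst`). The two
spaces are orthogonal complements.

Rank: X on the two columns beside the middle one is a product of a pair of columns measured under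
one cut and a pair measured under the other. It commutes with every vertical measurement, so once
formed it survives. From time 4 on, the stabilizer group is therefore `steadyGroup`, built from
`rowStab`, of rank d² - 2 (`finrank_rowStab`, `steadyGroup_succ`). The parent code accounts for one
of the two qubits.

Upper bound: X on the lower halves of these two columns, inserted at time 4, has weight d - 1. No
ancestry sees it, but it anticommutes with a record of conjugate Z operators that extends over all
times, and benign errors pair trivially with such records.

Lower bound (`mem_rowEven_of_checks`, for X errors): merge the errors between consecutive Z rounds
into one operator. Detectors comparing two half rows on the same side of the middle row show that
these half rows have equal parity. A nontrivial half row thus forces a whole block of d / 2 of them,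
each containing an error. Detectors comparing the middle row with a lower or an upper row, in
alternation, telescope and show that the number of nontrivial blocks is even. Below weight d - 1 =
2(d / 2) there are none, so each merged error is a product of measured operators and the error is
benign. -/

/-! ### Orthogonality over the field with two elements -/

section Duality

variable {V : Type} [Fintype V]

/-- The vectors whose dot product with every element of `S` vanishes. -/
def dotOrthogonal (S : Submodule (ZMod 2) (V → ZMod 2)) : Submodule (ZMod 2) (V → ZMod 2) where
  carrier := {B | ∀ A ∈ S, A ⬝ᵥ B = 0}
  zero_mem' := by intro A _; simp
  add_mem' := by
    intro B B' hB hB' A hA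
    rw [dotProduct_add, hB A hA, hB' A hA, add_zero]
  smul_mem' := by
    intro a B hB A hA
    rw [dotProduct_smul, hB A hA, smul_zero]

theorem mem_dotOrthogonal {S : Submodule (ZMod 2) (V → ZMod 2)} {B : V → ZMod 2} :
    B ∈ dotOrthogonal S ↔ ∀ A ∈ S, A ⬝ᵥ B = 0 := Iff.rfl

/-- Double orthogonality: a vector outside `S` is separated from it by a linear functional, and
every functional is a dot product. -/
theorem mem_of_forall_dotProduct [DecidableEq V] {S : Submodule (ZMod 2) (V → ZMod 2)}
    {C : V → ZMod 2}
    (h : ∀ B, (∀ A ∈ S, A ⬝ᵥ B = 0) → C ⬝ᵥ B = 0) : C ∈ S := by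
  by_contra hC
  obtain ⟨f, hf, hS⟩ := Submodule.exists_le_ker_of_notMem hC
  obtain ⟨B, rfl⟩ := (dotProductEquiv (ZMod 2) V).surjective f
  refine hf ?_
  have := h B fun A hA => by
    have := hS hA
    rw [LinearMap.mem_ker, dotProductEquiv_apply_apply] at this
    rw [dotProduct_comm, this]
  rw [dotProductEquiv_apply_apply, dotProduct_comm, this]

theorem finrank_add_finrank_dotOrthogonal [DecidableEq V]
    (S : Submodule (ZMod 2) (V → ZMod 2)) :
    Module.finrank (ZMod 2) S + Module.finrank (ZMod 2) (dotOrthogonal S) = Fintype.card V := by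
  have h : dotOrthogonal S =
      S.dualAnnihilator.map (dotProductEquiv (ZMod 2) V).symm.toLinearMap := by
    ext B
    rw [Submodule.mem_map_equiv, LinearEquiv.symm_symm, Submodule.mem_dualAnnihilator, mem_dotOrthogonal]
    refine forall₂_congr fun A _ => ?_
    rw [dotProductEquiv_apply_apply, dotProduct_comm]
  rw [h, LinearEquiv.finrank_map_eq, Subspace.finrank_add_finrank_dualAnnihilator_eq,
    Module.finrank_fintype_fun_eq_card]

theorem Pauli.comm_eq_dotProduct (P Q : Pauli V) : comm P Q = P.1 ⬝ᵥ Q.2 + P.2 ⬝ᵥ Q.1 :=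
  Finset.sum_add_distrib

end Duality

theorem ZMod.two_add_self (a : ZMod 2) : a + a = 0 := CharTwo.add_self_eq_zero a

/-! ### Spans and commutants of the measurement rounds -/

namespace FloquetBaconShor

/-- The sum over row `y`, restricted to the columns `x ≤ g`. -/
def leftSum {d : ℕ} (g : ℕ) (A : Fin d × Fin d → ZMod 2) (y : Fin d) : ZMod 2 :=
  ∑ x : Fin d, if (x : ℕ) ≤ g then A (x, y) else 0

/-- The sum over row `y`, restricted to the columns `x > g`. -/
def rightSum {d : ℕ} (g : ℕ) (A : Fin d × Fin d → ZMod 2) (y : Fin d) : ZMod 2 :=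
  ∑ x : Fin d, if g < (x : ℕ) then A (x, y) else 0

/-- The sum over row `y`. -/
def rowSum {d : ℕ} (A : Fin d × Fin d → ZMod 2) (y : Fin d) : ZMod 2 := ∑ x : Fin d, A (x, y)

section

variable {d : ℕ} (g : ℕ) (A B : Fin d × Fin d → ZMod 2) (a : ZMod 2) (y : Fin d)

theorem leftSum_add_rightSum : leftSum g A y + rightSum g A y = rowSum A y := by
  rw [leftSum, rightSum, rowSum, ← Finset.sum_add_distrib]
  refine Finset.sum_congr rfl fun x _ => ?_
  by_cases hx : (x : ℕ) ≤ g
  · rw [if_pos hx, if_neg (not_lt.mpr hx), add_zero]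
  · rw [if_neg hx, if_pos (not_le.mp hx), zero_add]

theorem leftSum_add : leftSum g (A + B) y = leftSum g A y + leftSum g B y := by
  simp only [leftSum, ← Finset.sum_add_distrib]
  refine Finset.sum_congr rfl fun x _ => ?_
  split_ifs <;> simp

theorem leftSum_smul : leftSum g (a • A) y = a * leftSum g A y := by
  simp [leftSum, Finset.mul_sum]

theorem rowSum_add : rowSum (A + B) y = rowSum A y + rowSum B y := by
  simp [rowSum, ← Finset.sum_add_distrib]

theorem rowSum_smul : rowSum (a • A) y = a * rowSum A y := by
  simp [rowSum, Finset.mul_sum]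

end

/-- The operators that are even on every component of the rows, where every row except the middle
one is cut after the column `g`. -/
def rowEven (d g : ℕ) : Submodule (ZMod 2) (Fin d × Fin d → ZMod 2) where
  carrier := {A | ∀ y, rowSum A y = 0 ∧ ((y : ℕ) ≠ d / 2 → leftSum g A y = 0)}
  zero_mem' := by intro y; simp [rowSum, leftSum]
  add_mem' := by
    intro A B hA hB y
    rw [rowSum_add, leftSum_add, (hA y).1, (hB y).1]
    exact ⟨add_zero _, fun hy => by rw [(hA y).2 hy, (hB y).2 hy, add_zero]⟩
  smul_mem' := by
    intro a A hA y
    rw [rowSum_smul, leftSum_smul, (hA y).1]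
    exact ⟨mul_zero _, fun hy => by rw [(hA y).2 hy, mul_zero]⟩

/-- The operators that are constant on every component of the rows, where every row except the
middle one is cut after the column `g`. -/
def rowConst (d g : ℕ) : Submodule (ZMod 2) (Fin d × Fin d → ZMod 2) where
  carrier := {B | ∀ x x' y : Fin d, ((y : ℕ) = d / 2 ∨ ((x : ℕ) ≤ g ↔ (x' : ℕ) ≤ g)) →
    B (x, y) = B (x', y)}
  zero_mem' := by intro x x' y _; rfl
  add_mem' := by
    intro A B hA hB x x' y h
    rw [Pi.add_apply, Pi.add_apply, hA x x' y h, hB x x' y h]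
  smul_mem' := by
    intro a A hA x x' y h
    rw [Pi.smul_apply, Pi.smul_apply, hA x x' y h]

/-- Exchange of the two coordinates of the grid. -/
def transpose (d : ℕ) : (Fin d × Fin d → ZMod 2) ≃ₗ[ZMod 2] (Fin d × Fin d → ZMod 2) :=
  LinearEquiv.funCongrLeft (ZMod 2) (ZMod 2) (Equiv.prodComm _ _)

@[simp]
theorem transpose_apply {d : ℕ} (A : Fin d × Fin d → ZMod 2) (x y : Fin d) :
    transpose d A (x, y) = A (y, x) := rfl

@[simp]
theorem transpose_transpose {d : ℕ} (A : Fin d × Fin d → ZMod 2) :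
    transpose d (transpose d A) = A := rfl

theorem transpose_dotProduct {d : ℕ} (A B : Fin d × Fin d → ZMod 2) :
    transpose d A ⬝ᵥ transpose d B = A ⬝ᵥ B :=
  (Equiv.prodComm (Fin d) (Fin d)).sum_comp fun v => A v * B v

/-- The transposed submodule. -/
def transposed {d : ℕ} (S : Submodule (ZMod 2) (Fin d × Fin d → ZMod 2)) :
    Submodule (ZMod 2) (Fin d × Fin d → ZMod 2) :=
  S.comap (transpose d).toLinearMap

theorem mem_transposed {d : ℕ} {S : Submodule (ZMod 2) (Fin d × Fin d → ZMod 2)}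
    {A : Fin d × Fin d → ZMod 2} : A ∈ transposed S ↔ transpose d A ∈ S := Iff.rfl

theorem transposed_eq_map {d : ℕ} (S : Submodule (ZMod 2) (Fin d × Fin d → ZMod 2)) :
    transposed S = S.map (transpose d).toLinearMap :=
  Submodule.comap_equiv_eq_map_symm _ _

theorem transposed_transposed {d : ℕ} (S : Submodule (ZMod 2) (Fin d × Fin d → ZMod 2)) :
    transposed (transposed S) = S := rfl

theorem transposed_sup {d : ℕ} (S T : Submodule (ZMod 2) (Fin d × Fin d → ZMod 2)) :
    transposed (S ⊔ T) = transposed S ⊔ transposed T := by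
  simp only [transposed_eq_map, Submodule.map_sup]

theorem transposed_inf {d : ℕ} (S T : Submodule (ZMod 2) (Fin d × Fin d → ZMod 2)) :
    transposed (S ⊓ T) = transposed S ⊓ transposed T := rfl

theorem finrank_transposed {d : ℕ} (S : Submodule (ZMod 2) (Fin d × Fin d → ZMod 2)) :
    Module.finrank (ZMod 2) (transposed S) = Module.finrank (ZMod 2) S := by
  rw [transposed_eq_map]
  exact LinearEquiv.finrank_map_eq _ _

theorem sum_ite_mul_eq_zero {ι : Type} [Fintype ι] {p : ι → Prop} [DecidablePred p]
    {f h : ι → ZMod 2} (hh : ∀ i j, p i → p j → h i = h j)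
    (hf : (∑ i, if p i then f i else 0) = 0) : (∑ i, if p i then f i * h i else 0) = 0 := by
  by_cases hex : ∃ j, p j
  · obtain ⟨j, hj⟩ := hex
    have : ∀ i, (if p i then f i * h i else 0) = (if p i then f i else 0) * h j := by
      intro i
      split_ifs with hi
      · rw [hh i j hi hj]
      · rw [zero_mul]
    rw [Finset.sum_congr rfl fun i _ => this i, ← Finset.sum_mul, hf, zero_mul]
  · push Not at hex
    exact Finset.sum_eq_zero fun i _ => if_neg (hex i)

theorem dotProduct_eq_zero {d g : ℕ} {A B : Fin d × Fin d → ZMod 2} (hA : A ∈ rowEven d g)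
    (hB : B ∈ rowConst d g) : A ⬝ᵥ B = 0 := by
  rw [dotProduct, Fintype.sum_prod_type_right]
  refine Finset.sum_eq_zero fun y _ => ?_
  obtain ⟨h1, h2⟩ := hA y
  by_cases hy : (y : ℕ) = d / 2
  · have := sum_ite_mul_eq_zero (p := fun _ : Fin d => True) (f := fun x => A (x, y))
      (h := fun x => B (x, y)) (fun x x' _ _ => hB x x' y (Or.inl hy)) (by simpa [rowSum] using h1)
    simpa using this
  · have h3 := h2 hy
    have h4 : rightSum g A y = 0 := by
      rw [← leftSum_add_rightSum g, h3, zero_add] at h1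
      exact h1
    have h5 := sum_ite_mul_eq_zero (fun x x' hx hx' => hB x x' y (Or.inr (iff_of_true hx hx'))) h3
    have h6 := sum_ite_mul_eq_zero
      (fun x x' hx hx' => hB x x' y (Or.inr (iff_of_false (not_le.mpr hx) (not_le.mpr hx')))) h4
    rw [← add_zero (0 : ZMod 2), ← congrArg₂ (· + ·) h5 h6, ← Finset.sum_add_distrib]
    refine Finset.sum_congr rfl fun x _ => ?_
    by_cases hx : (x : ℕ) ≤ g
    · rw [if_pos hx, if_neg (not_lt.mpr hx), add_zero]
    · rw [if_neg hx, if_pos (not_le.mp hx), zero_add]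

theorem mem_rowConst_of_edges {d g : ℕ} {B : Fin d × Fin d → ZMod 2}
    (h : ∀ x x' y : Fin d, (x' : ℕ) = (x : ℕ) + 1 → ((y : ℕ) = d / 2 ∨ (x : ℕ) ≠ g) →
      B (x, y) = B (x', y)) : B ∈ rowConst d g := by
  have key : ∀ (n : ℕ) (x x' y : Fin d), (x' : ℕ) = x + n →
      ((y : ℕ) = d / 2 ∨ ((x : ℕ) ≤ g ↔ (x' : ℕ) ≤ g)) → B (x, y) = B (x', y) := by
    intro n
    induction n with
    | zero => intro x x' y hx _; rw [Fin.ext hx]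
    | succ n ih =>
      -- Walking right along the row never crosses the cut, because both endpoints lie on the same
      -- side of it or the row is uncut.
      intro x x' y hx hy
      have hlt : (x : ℕ) + n < d := by omega
      rw [ih x ⟨x + n, hlt⟩ y rfl (by simp only; omega)]
      exact h _ x' y (by simp only; omega) (by simp only; omega)
  intro x x' y hy
  rcases le_total (x : ℕ) x' with hx | hx
  · exact key (x' - x) x x' y (by omega) hy
  · exact (key (x - x') x' x y (by omega) (by omega)).symm

theorem edge_mem_rowEven {d g : ℕ} {x x' y : Fin d} (hx : (x' : ℕ) = (x : ℕ) + 1)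
    (hy : (y : ℕ) = d / 2 ∨ (x : ℕ) ≠ g) :
    (Pi.single (x, y) 1 + Pi.single (x', y) 1 : Fin d × Fin d → ZMod 2) ∈ rowEven d g := by
  intro w
  rw [rowSum_add, leftSum_add]
  by_cases hw : w = y
  · subst hw
    simp only [rowSum, leftSum, Pi.single_apply, Prod.mk.injEq, and_true, Finset.sum_ite_eq',
      Finset.mem_univ, if_true]
    refine ⟨rfl, fun hw => ?_⟩
    simp only [← ite_and, and_comm (b := (_ : Fin d) = _)]
    simp only [ite_and, Finset.sum_ite_eq', Finset.mem_univ, if_true]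
    have : (x : ℕ) ≤ g ↔ (x' : ℕ) ≤ g := by omega
    simp only [this]
    exact ZMod.two_add_self _
  · simp [rowSum, leftSum, hw]

theorem mem_rowConst_iff_edges {d g : ℕ} {B : Fin d × Fin d → ZMod 2} :
    B ∈ rowConst d g ↔ ∀ x x' y : Fin d, (x' : ℕ) = (x : ℕ) + 1 →
      ((y : ℕ) = d / 2 ∨ (x : ℕ) ≠ g) →
        (Pi.single (x, y) 1 + Pi.single (x', y) 1 : Fin d × Fin d → ZMod 2) ⬝ᵥ B = 0 := by
  refine ⟨fun h x x' y hx hy => dotProduct_eq_zero (edge_mem_rowEven hx hy) h, fun h => ?_⟩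
  refine mem_rowConst_of_edges fun x x' y hx hy => ?_
  have := h x x' y hx hy
  rw [add_dotProduct, single_one_dotProduct, single_one_dotProduct] at this
  exact CharTwo.add_eq_zero.mp this

/-- Spanning follows by duality, without decomposing an even operator into edges: a vector
orthogonal to all measured edges is constant on components, hence orthogonal to every even operator.
-/
theorem span_horizontal (d g : ℕ) :
    Submodule.span (ZMod 2) (horizontal d g) = (rowEven d g).prod ⊥ := by
  apply le_antisymm
  · rw [Submodule.span_le]
    rintro _ ⟨x, x', y, hx, hy, rfl⟩
    exact ⟨edge_mem_rowEven hx hy, by simp [Pauli.X]⟩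
  · rintro ⟨A, B⟩ ⟨hA, hB⟩
    obtain rfl : B = 0 := hB
    change A ∈ (Submodule.span (ZMod 2) (horizontal d g)).comap (LinearMap.inl _ _ _)
    refine mem_of_forall_dotProduct fun C hC => dotProduct_eq_zero hA ?_
    rw [mem_rowConst_iff_edges]
    intro x x' y hx hy
    refine hC _ (Submodule.subset_span ⟨x, x', y, hx, hy, ?_⟩)
    simp [Pauli.X]

theorem commutant_horizontal (d g : ℕ) :
    Pauli.commutant (horizontal d g) = Submodule.prod ⊤ (rowConst d g) := by
  ext P
  rw [Submodule.mem_prod, mem_rowConst_iff_edges]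
  constructor
  · refine fun h => ⟨trivial, fun x x' y hx hy => ?_⟩
    have := h _ ⟨x, x', y, hx, hy, rfl⟩
    rw [Pauli.comm_eq_dotProduct] at this
    rw [dotProduct_comm]
    simpa [Pauli.X] using this
  · rintro ⟨-, h⟩ _ ⟨x, x', y, hx, hy, rfl⟩
    have := h x x' y hx hy
    rw [dotProduct_comm] at this
    rw [Pauli.comm_eq_dotProduct]
    simpa [Pauli.X] using this

/-- Exchange of the two coordinates together with the exchange of `X` and `Z`. -/
def pauliTranspose (d : ℕ) : Pauli (Fin d × Fin d) ≃ₗ[ZMod 2] Pauli (Fin d × Fin d) :=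
  (LinearEquiv.prodComm _ _ _).trans ((transpose d).prodCongr (transpose d))

@[simp]
theorem pauliTranspose_apply {d : ℕ} (P : Pauli (Fin d × Fin d)) :
    pauliTranspose d P = (transpose d P.2, transpose d P.1) := rfl

theorem comm_pauliTranspose {d : ℕ} (P Q : Pauli (Fin d × Fin d)) :
    Pauli.comm (pauliTranspose d P) (pauliTranspose d Q) = Pauli.comm P Q := by
  simp only [Pauli.comm_eq_dotProduct, pauliTranspose_apply, transpose_dotProduct]
  rw [add_comm]

theorem transpose_single {d : ℕ} (x y : Fin d) :
    transpose d (Pi.single (x, y) 1) = Pi.single (y, x) 1 := by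
  ext ⟨u, v⟩
  simp [Pi.single_apply, and_comm]

theorem vertical_eq_image (d g : ℕ) : vertical d g = pauliTranspose d '' horizontal d g := by
  ext P
  constructor
  · rintro ⟨x, y, y', hy, hx, rfl⟩
    refine ⟨_, ⟨y, y', x, hy, hx, rfl⟩, ?_⟩
    simp [Pauli.X, Pauli.Z, transpose_single]
  · rintro ⟨_, ⟨y, y', x, hy, hx, rfl⟩, rfl⟩
    refine ⟨x, y, y', hy, hx, ?_⟩
    simp [Pauli.X, Pauli.Z, transpose_single]

theorem span_vertical (d g : ℕ) :
    Submodule.span (ZMod 2) (vertical d g) = Submodule.prod ⊥ (transposed (rowEven d g)) := by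
  rw [vertical_eq_image, ← LinearEquiv.coe_coe, Submodule.span_image, span_horizontal]
  ext P
  rw [Submodule.mem_map_equiv]
  exact ⟨fun h => ⟨(LinearEquiv.map_eq_zero_iff (transpose d)).mp h.2, h.1⟩,
    fun h => ⟨h.2, (LinearEquiv.map_eq_zero_iff (transpose d)).mpr h.1⟩⟩

theorem commutant_vertical (d g : ℕ) :
    Pauli.commutant (vertical d g) = Submodule.prod (transposed (rowConst d g)) ⊤ := by
  have h : ∀ P, P ∈ Pauli.commutant (vertical d g) ↔
      pauliTranspose d P ∈ Pauli.commutant (horizontal d g) := by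
    intro P
    rw [vertical_eq_image]
    constructor
    · intro h Q hQ
      rw [← h _ ⟨Q, hQ, rfl⟩, ← comm_pauliTranspose]
      simp
    · rintro h _ ⟨Q, hQ, rfl⟩
      rw [← h Q hQ, ← comm_pauliTranspose]
      simp
  ext P
  rw [h, commutant_horizontal]
  exact ⟨fun h => ⟨h.2, trivial⟩, fun h => ⟨trivial, h.1⟩⟩

end FloquetBaconShor

/-! ### Side columns and the dimension count -/

theorem finrank_inf_ker_add {K M N : Type} [Field K] [AddCommGroup M] [Module K M]
    [FiniteDimensional K M] [AddCommGroup N] [Module K N]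
    (S : Submodule K M) (f : M →ₗ[K] N) (h : ∀ w, ∃ v ∈ S, f v = w) :
    Module.finrank K ↥(S ⊓ LinearMap.ker f) + Module.finrank K N = Module.finrank K S := by
  have h1 := LinearMap.finrank_range_add_finrank_ker (f.domRestrict S)
  have h2 : LinearMap.range (f.domRestrict S) = ⊤ := by
    rw [LinearMap.range_eq_top]
    intro w
    obtain ⟨v, hv, hw⟩ := h w
    exact ⟨⟨v, hv⟩, hw⟩
  have h3 : S ⊓ LinearMap.ker f = (LinearMap.ker (f.domRestrict S)).map S.subtype := by
    ext v
    simp [Submodule.mem_map, and_comm]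
  rw [h2, finrank_top] at h1
  rw [h3, Submodule.finrank_map_subtype_eq, add_comm, h1]

theorem finrank_prod_submodule {K M N : Type} [Field K] [AddCommGroup M] [Module K M]
    [FiniteDimensional K M] [AddCommGroup N] [Module K N] [FiniteDimensional K N]
    (S : Submodule K M) (T : Submodule K N) :
    Module.finrank K ↥(S.prod T) = Module.finrank K S + Module.finrank K T := by
  rw [← Module.finrank_prod]
  have : S.prod T = LinearMap.range (S.subtype.prodMap T.subtype) := by
    ext ⟨a, b⟩
    simp [Submodule.mem_prod]
  rw [this]
  refine LinearMap.finrank_range_of_inj ?_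
  rintro ⟨a, b⟩ ⟨a', b'⟩ h
  simpa using h

namespace FloquetBaconShor

/-- The indicator function of a column. -/
def column (d n : ℕ) (v : Fin d × Fin d) : ZMod 2 := if (v.1 : ℕ) = n then 1 else 0

theorem rowSum_column {d n : ℕ} (hn : n < d) (y : Fin d) : rowSum (column d n) y = 1 := by
  rw [rowSum, Finset.sum_eq_single (⟨n, hn⟩ : Fin d)]
  · simp [column]
  · intro x _ hx
    exact if_neg fun h => hx (Fin.ext h)
  · simp

theorem leftSum_column {d n : ℕ} (hn : n < d) (g : ℕ) (y : Fin d) :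
    leftSum g (column d n) y = if n ≤ g then 1 else 0 := by
  rw [leftSum, Finset.sum_eq_single (⟨n, hn⟩ : Fin d)]
  · simp [column]
  · intro x _ hx
    rw [column, if_neg fun h => hx (Fin.ext h), ite_self]
  · simp

theorem column_mem (d g n : ℕ) : column d n ∈ transposed (rowConst d g) :=
  fun _ _ _ _ => rfl

theorem column_dotProduct {d n : ℕ} (hn : n < d) (B : Fin d × Fin d → ZMod 2) :
    column d n ⬝ᵥ B = rowSum (transpose d B) ⟨n, hn⟩ := by
  rw [dotProduct, Fintype.sum_prod_type, Finset.sum_eq_single (⟨n, hn⟩ : Fin d)]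
  · simp [column, rowSum]
  · intro x _ hx
    refine Finset.sum_eq_zero fun y _ => ?_
    rw [column, if_neg fun h => hx (Fin.ext h), zero_mul]
  · simp

/-- The two columns next to the middle column. -/
def sideColumns (d : ℕ) : Fin d × Fin d → ZMod 2 := column d (d / 2 - 1) + column d (d / 2 + 1)

theorem sideColumns_mem (d g : ℕ) : sideColumns d ∈ transposed (rowConst d g) :=
  add_mem (column_mem _ _ _) (column_mem _ _ _)

theorem rowSum_sideColumns {d : ℕ} (hd : 3 ≤ d) (y : Fin d) : rowSum (sideColumns d) y = 0 := by
  rw [sideColumns, rowSum_add, rowSum_column (by omega), rowSum_column (by omega)]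
  rfl

/-- Either cut separates the two columns. The pair is thus not even on half rows, and is a
stabilizer that no single round measures. -/
theorem leftSum_sideColumns {d : ℕ} (hd : 3 ≤ d) {g : ℕ} (hg : g = d / 2 ∨ g = d / 2 - 1)
    (y : Fin d) : leftSum g (sideColumns d) y = 1 := by
  rw [sideColumns, leftSum_add, leftSum_column (by omega), leftSum_column (by omega),
    if_pos (by omega), if_neg (by omega), add_zero]

theorem sideColumns_dotProduct {d : ℕ} (hd : 3 ≤ d) (B : Fin d × Fin d → ZMod 2) :
    sideColumns d ⬝ᵥ B = rowSum (transpose d B) ⟨d / 2 - 1, by omega⟩ +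
      rowSum (transpose d B) ⟨d / 2 + 1, by omega⟩ := by
  rw [sideColumns, add_dotProduct, column_dotProduct, column_dotProduct]

/-- The span of the row operators and of the pair of columns next to the middle column. -/
def rowStab (d g : ℕ) : Submodule (ZMod 2) (Fin d × Fin d → ZMod 2) :=
  rowEven d g ⊔ Submodule.span (ZMod 2) {sideColumns d}

theorem mem_rowStab {d g : ℕ} {A : Fin d × Fin d → ZMod 2} :
    A ∈ rowStab d g ↔ ∃ s : ZMod 2, A + s • sideColumns d ∈ rowEven d g := by
  rw [rowStab, Submodule.mem_sup]
  constructor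
  · rintro ⟨B, hB, C, hC, rfl⟩
    obtain ⟨s, rfl⟩ := Submodule.mem_span_singleton.mp hC
    refine ⟨s, ?_⟩
    rwa [add_assoc, ← add_smul, ZMod.two_add_self, zero_smul, add_zero]
  · rintro ⟨s, hs⟩
    refine ⟨_, hs, s • sideColumns d, Submodule.smul_mem _ _ (Submodule.mem_span_singleton_self _), ?_⟩
    rw [add_assoc, ← add_smul, ZMod.two_add_self, zero_smul, add_zero]

theorem rowSum_congr {d : ℕ} {B : Fin d × Fin d → ZMod 2} {y y' : Fin d}
    (h : ∀ x, B (x, y) = B (x, y')) : rowSum B y = rowSum B y' :=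
  Finset.sum_congr rfl fun x _ => h x

theorem leftSum_congr {d g : ℕ} {B : Fin d × Fin d → ZMod 2} {y y' : Fin d}
    (h : ∀ x, B (x, y) = B (x, y')) : leftSum g B y = leftSum g B y' :=
  Finset.sum_congr rfl fun x _ => by rw [h x]

/-- The left parts of the two rows next to the middle row. -/
def leftSideRows (d g : ℕ) (v : Fin d × Fin d) : ZMod 2 :=
  if (v.1 : ℕ) ≤ g then transpose d (sideColumns d) v else 0

theorem leftSideRows_mem {d : ℕ} (hd : 3 ≤ d) (g : ℕ) : leftSideRows d g ∈ rowConst d g := by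
  intro x x' y h
  have key : transpose d (sideColumns d) (x, y) = transpose d (sideColumns d) (x', y) := rfl
  rcases h with h | h
  · have h0 : transpose d (sideColumns d) (x', y) = 0 := by
      simp only [transpose_apply, sideColumns, Pi.add_apply, column]
      rw [if_neg (show ¬ (y : ℕ) = d / 2 - 1 by omega), if_neg (show ¬ (y : ℕ) = d / 2 + 1 by omega),
        add_zero]
    simp only [leftSideRows, key, h0, ite_self]
  · simp only [leftSideRows, key, h]

theorem rowSum_transpose_leftSideRows {d : ℕ} (hd : 3 ≤ d) (g : ℕ) (x : Fin d) :
    rowSum (transpose d (leftSideRows d g)) x = 0 := by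
  have := rowSum_sideColumns hd x
  simp only [rowSum, transpose_apply, leftSideRows] at this ⊢
  split_ifs
  · exact this
  · simp

theorem leftSum_transpose_leftSideRows {d : ℕ} (hd : 3 ≤ d) (g : ℕ) {g' : ℕ}
    (hg : g' = d / 2 ∨ g' = d / 2 - 1) (x : Fin d) :
    leftSum g' (transpose d (leftSideRows d g)) x = if (x : ℕ) ≤ g then 1 else 0 := by
  have := leftSum_sideColumns hd hg x
  simp only [leftSum, transpose_apply, leftSideRows] at this ⊢
  split_ifs
  · exact this
  · simp

theorem mem_dotOrthogonal_rowStab {d g : ℕ} {B : Fin d × Fin d → ZMod 2} :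
    B ∈ dotOrthogonal (rowStab d g) ↔ B ∈ rowConst d g ∧ sideColumns d ⬝ᵥ B = 0 := by
  constructor
  · refine fun h => ⟨mem_rowConst_iff_edges.mpr fun x x' y hx hy => h _ ?_, h _ ?_⟩
    · exact Submodule.mem_sup_left (edge_mem_rowEven hx hy)
    · exact Submodule.mem_sup_right (Submodule.mem_span_singleton_self _)
  · rintro ⟨h1, h2⟩ A hA
    obtain ⟨s, hs⟩ := mem_rowStab.mp hA
    have := dotProduct_eq_zero hs h1
    rwa [add_dotProduct, smul_dotProduct, h2, smul_zero, add_zero] at this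

/-- The second space is cut out of the orthogonal complement of the first by two independent linear
conditions, hence the defect 2. -/
theorem finrank_rowStab {d : ℕ} (hd : 3 ≤ d) (hodd : d % 2 = 1) {g g' : ℕ}
    (hg : g = d / 2 ∨ g = d / 2 - 1) (hg' : g' = d / 2 ∨ g' = d / 2 - 1) :
    Module.finrank (ZMod 2) (rowStab d g) +
      Module.finrank (ZMod 2) ↥(rowConst d g ⊓ transposed (rowStab d g')) + 2 = d * d := by
  let z : Fin d := ⟨0, by omega⟩
  let w : Fin d := ⟨d - 1, by omega⟩
  -- All columns on one side of the cut `g` agree, so columns `z` and `w` represent the two sides.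
  -- The conditions are equal lower sums in both and even total in `z`; orthogonality to the side
  -- columns then makes `w` even too.
  let f : (Fin d × Fin d → ZMod 2) →ₗ[ZMod 2] ZMod 2 × ZMod 2 :=
    { toFun := fun B => (leftSum g' (transpose d B) z + leftSum g' (transpose d B) w,
        rowSum (transpose d B) z)
      map_add' := fun B C => by
        ext
        · simp only [map_add, leftSum_add, Prod.fst_add]
          ring
        · simp only [map_add, rowSum_add, Prod.snd_add]
      map_smul' := fun a B => by
        ext
        · simp only [map_smul, leftSum_smul, Prod.smul_fst, RingHom.id_apply, smul_eq_mul]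
          ring
        · simp only [map_smul, rowSum_smul, Prod.smul_snd, RingHom.id_apply, smul_eq_mul] }
  have hf : ∀ B, f B = (leftSum g' (transpose d B) z + leftSum g' (transpose d B) w,
        rowSum (transpose d B) z) := fun _ => rfl
  have hker : rowConst d g ⊓ transposed (rowStab d g') =
      dotOrthogonal (rowStab d g) ⊓ LinearMap.ker f := by
    ext B
    rw [Submodule.mem_inf, Submodule.mem_inf, mem_dotOrthogonal_rowStab, LinearMap.mem_ker,
      mem_transposed, mem_rowStab, hf, sideColumns_dotProduct hd, and_assoc, Prod.mk_eq_zero]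
    refine and_congr_right fun hB => ?_
    have hcol : ∀ x x' : Fin d, ((x : ℕ) ≤ g ↔ (x' : ℕ) ≤ g) →
        rowSum (transpose d B) x = rowSum (transpose d B) x' ∧
        leftSum g' (transpose d B) x = leftSum g' (transpose d B) x' := fun x x' h =>
      ⟨rowSum_congr fun y => hB x x' y (Or.inr h), leftSum_congr fun y => hB x x' y (Or.inr h)⟩
    constructor
    · rintro ⟨s, hs⟩
      have hr : ∀ x, rowSum (transpose d B) x = 0 := by
        intro x
        have := (hs x).1
        rwa [rowSum_add, rowSum_smul, rowSum_sideColumns hd, mul_zero, add_zero] at this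
      have hl : ∀ x : Fin d, (x : ℕ) ≠ d / 2 → leftSum g' (transpose d B) x = s := by
        intro x hx
        have := (hs x).2 hx
        rw [leftSum_add, leftSum_smul, leftSum_sideColumns hd hg', mul_one] at this
        exact CharTwo.add_eq_zero.mp this
      refine ⟨by rw [hr, hr, add_zero], ?_, hr z⟩
      rw [hl z (by simp only [z]; omega), hl w (by simp only [w]; omega), ZMod.two_add_self]
    · rintro ⟨h1, h2, h3⟩
      rw [(hcol _ z (by simp only [z]; omega)).1, h3, zero_add] at h1
      have h4 : rowSum (transpose d B) w = 0 := by
        rw [← h1, (hcol w ⟨d / 2 + 1, by omega⟩ (by simp only [w]; omega)).1]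
      refine ⟨leftSum g' (transpose d B) z, fun x => ?_⟩
      rw [rowSum_add, leftSum_add, rowSum_smul, leftSum_smul, rowSum_sideColumns hd,
        leftSum_sideColumns hd hg', mul_zero, add_zero, mul_one]
      by_cases hx : (x : ℕ) ≤ g
      · obtain ⟨h5, h6⟩ := hcol x z (by simp only [z]; omega)
        rw [h5, h6]
        exact ⟨h3, fun _ => ZMod.two_add_self _⟩
      · obtain ⟨h5, h6⟩ := hcol x w (by simp only [w]; omega)
        rw [h5, h6, add_comm]
        exact ⟨h4, fun _ => h2⟩
  have hsurj : ∀ p, ∃ B ∈ dotOrthogonal (rowStab d g), f B = p := by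
    -- Witnesses for surjectivity: a full row maps to (0, 1), and the left halves of the two side
    -- rows map to (1, 0).
    have hT : transpose d (column d (d / 2 - 1)) ∈ dotOrthogonal (rowStab d g) := by
      rw [mem_dotOrthogonal_rowStab]
      refine ⟨column_mem d g _, ?_⟩
      rw [sideColumns_dotProduct hd, transpose_transpose, rowSum_column (by omega),
        rowSum_column (by omega)]
      rfl
    have hS : leftSideRows d g ∈ dotOrthogonal (rowStab d g) := by
      rw [mem_dotOrthogonal_rowStab]
      refine ⟨leftSideRows_mem hd g, ?_⟩
      rw [sideColumns_dotProduct hd, rowSum_transpose_leftSideRows hd,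
        rowSum_transpose_leftSideRows hd, add_zero]
    rintro ⟨a, b⟩
    refine ⟨a • leftSideRows d g + b • transpose d (column d (d / 2 - 1)),
      add_mem (Submodule.smul_mem _ _ hS) (Submodule.smul_mem _ _ hT), ?_⟩
    rw [map_add, map_smul, map_smul, hf, hf, transpose_transpose, rowSum_transpose_leftSideRows hd,
      leftSum_transpose_leftSideRows hd g hg', leftSum_transpose_leftSideRows hd g hg',
      rowSum_column (by omega), leftSum_column (by omega), leftSum_column (by omega),
      ZMod.two_add_self, if_pos (by simp [z]), if_neg (by simp only [w]; omega)]
    simp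
  have h1 := finrank_add_finrank_dotOrthogonal (rowStab d g)
  have h2 := finrank_inf_ker_add _ f hsurj
  rw [Fintype.card_prod, Fintype.card_fin] at h1
  rw [Module.finrank_prod, Module.finrank_self, ← hker] at h2
  omega

/-! ### Evolution of the stabilizer group and the steady stage -/

/-- The column after which the rows, or the row after which the columns, are cut at time `t`. -/
def gap (d t : ℕ) : ℕ := if t % 4 = 1 ∨ t % 4 = 2 then d / 2 else d / 2 - 1

theorem gap_eq (d t : ℕ) : gap d t = d / 2 ∨ gap d t = d / 2 - 1 := by
  unfold gap
  split_ifs <;> simp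

theorem schedule_odd (d : ℕ) {t : ℕ} (ht : t % 2 = 1) : schedule d t = horizontal d (gap d t) := by
  rcases (by omega : t % 4 = 1 ∨ t % 4 = 3) with h | h <;> simp [schedule, gap, h]

theorem schedule_even (d : ℕ) {t : ℕ} (ht : t % 2 = 0) : schedule d t = vertical d (gap d t) := by
  rcases (by omega : t % 4 = 2 ∨ t % 4 = 0) with h | h <;> simp [schedule, gap, h]

theorem code_meas (d t : ℕ) : (code d).meas t = schedule d t := rfl

theorem span_odd (d : ℕ) {t : ℕ} (ht : t % 2 = 1) :
    Submodule.span (ZMod 2) ((code d).meas t) = (rowEven d (gap d t)).prod ⊥ := by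
  rw [code_meas, schedule_odd d ht, span_horizontal]

theorem span_even (d : ℕ) {t : ℕ} (ht : t % 2 = 0) :
    Submodule.span (ZMod 2) ((code d).meas t) =
      Submodule.prod ⊥ (transposed (rowEven d (gap d t))) := by
  rw [code_meas, schedule_even d ht, span_vertical]

theorem commutant_odd (d : ℕ) {t : ℕ} (ht : t % 2 = 1) :
    Pauli.commutant ((code d).meas t) = Submodule.prod ⊤ (rowConst d (gap d t)) := by
  rw [code_meas, schedule_odd d ht, commutant_horizontal]

theorem commutant_even (d : ℕ) {t : ℕ} (ht : t % 2 = 0) :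
    Pauli.commutant ((code d).meas t) =
      Submodule.prod (transposed (rowConst d (gap d t))) ⊤ := by
  rw [code_meas, schedule_even d ht, commutant_vertical]

/-- A round of measurements replaces the row stabilizers with one gap by those with the other. -/
theorem rowEven_sup_rowStab {d : ℕ} (hd : 3 ≤ d) (g : ℕ) {g' h : ℕ}
    (hgh : g' = d / 2 - 1 ∧ h = d / 2 ∨ g' = d / 2 ∧ h = d / 2 - 1) :
    rowEven d h ⊔ (rowStab d g' ⊓ transposed (rowConst d g)) = rowStab d h := by
  apply le_antisymm
  · refine sup_le le_sup_left ?_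
    rintro A ⟨hA, hAc⟩
    obtain ⟨s, hs⟩ := mem_rowStab.mp hA
    have hB : A + s • sideColumns d ∈ transposed (rowConst d g) :=
      add_mem hAc (Submodule.smul_mem _ _ (sideColumns_mem d g))
    -- Adding the side columns twice reduces to the case of an operator in `rowEven d g'`.
    rw [← add_zero A, ← zero_smul (ZMod 2) (sideColumns d), ← ZMod.two_add_self s, add_smul,
      ← add_assoc]
    refine add_mem ?_ (Submodule.smul_mem _ _
      (Submodule.mem_sup_right (Submodule.mem_span_singleton_self _)))
    generalize A + s • sideColumns d = B at hs hB
    let m : Fin d := ⟨d / 2, by omega⟩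
    refine mem_rowStab.mpr ⟨B (m, m), fun y => ?_⟩
    rw [rowSum_add, leftSum_add, rowSum_smul, leftSum_smul, rowSum_sideColumns hd,
      leftSum_sideColumns hd (by omega), mul_zero, add_zero, mul_one]
    refine ⟨(hs y).1, fun hy => ?_⟩
    have h1 := (hs y).2 hy
    -- The middle column is never cut, so `B` is constant along it.
    have h2 : B (m, y) = B (m, m) := hB y m m (Or.inl rfl)
    -- The two cuts lie on either side of the middle column, so the left sums differ by its entry
    -- alone. This entry is the same in every row and is corrected by one multiple of the side
    -- columns.
    have h3 : leftSum h B y + leftSum g' B y = B (m, y) := by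
      rw [leftSum, leftSum, ← Finset.sum_add_distrib, Finset.sum_eq_single m]
      · rcases hgh with ⟨rfl, rfl⟩ | ⟨rfl, rfl⟩
        · rw [if_pos (by simp [m]), if_neg (by simp only [m]; omega), add_zero]
        · rw [if_neg (by simp only [m]; omega), if_pos (by simp [m]), zero_add]
      · intro x _ hx
        have hx' : (x : ℕ) ≠ d / 2 := fun h => hx (Fin.ext h)
        have : (x : ℕ) ≤ h ↔ (x : ℕ) ≤ g' := by omega
        simp only [this]
        exact ZMod.two_add_self _
      · simp
    rw [h1, add_zero] at h3
    rw [h3, h2, ZMod.two_add_self]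
  · refine sup_le le_sup_left ?_
    rw [Submodule.span_singleton_le_iff_mem]
    exact Submodule.mem_sup_right ⟨Submodule.mem_sup_right (Submodule.mem_span_singleton_self _),
      sideColumns_mem d g⟩

/-- This is where the side columns are born: their sum splits at the middle column into a surviving
column pair of the old cut and a column pair of the new one. -/
theorem rowEven_sup_rowEven {d : ℕ} (hd : 3 ≤ d) (g : ℕ) :
    rowEven d (d / 2 - 1) ⊔ (rowEven d (d / 2) ⊓ transposed (rowConst d g)) =
      rowStab d (d / 2 - 1) := by
  apply le_antisymm
  · rw [← rowEven_sup_rowStab hd g (Or.inr ⟨rfl, rfl⟩)]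
    exact sup_le_sup_left (inf_le_inf_right _ le_sup_left) _
  · refine sup_le le_sup_left ?_
    rw [Submodule.span_singleton_le_iff_mem]
    have h : sideColumns d = (column d (d / 2) + column d (d / 2 + 1)) +
        (column d (d / 2 - 1) + column d (d / 2)) := by
      have h0 : column d (d / 2) + column d (d / 2) = 0 := by
        ext v
        exact ZMod.two_add_self _
      rw [sideColumns, ← zero_add (_ + _), ← h0]
      abel
    rw [h]
    refine add_mem (Submodule.mem_sup_left fun y => ?_) (Submodule.mem_sup_right
      ⟨fun y => ?_, add_mem (column_mem _ _ _) (column_mem _ _ _)⟩)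
    all_goals
      rw [rowSum_add, leftSum_add, rowSum_column (by omega), rowSum_column (by omega),
        leftSum_column (by omega), leftSum_column (by omega)]
    · rw [if_neg (by omega), if_neg (by omega)]
      exact ⟨rfl, fun _ => rfl⟩
    · rw [if_pos (by omega), if_pos (by omega)]
      exact ⟨rfl, fun _ => rfl⟩

end FloquetBaconShor

namespace DynamicalCode

variable {V : Type} [Fintype V] (D : DynamicalCode V)

theorem ISG_zero : D.ISG 0 = ⊥ := rfl

theorem ISG_succ (t : ℕ) : D.ISG (t + 1) = Submodule.span (ZMod 2) (D.meas (t + 1)) ⊔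
    (D.ISG t ⊓ Pauli.commutant (D.meas (t + 1))) := rfl

end DynamicalCode

namespace FloquetBaconShor

/-- The stabilizer group that the code reaches in the steady stage. -/
def steadyGroup (d t : ℕ) : Submodule (ZMod 2) (Pauli (Fin d × Fin d)) :=
  if t % 2 = 1 then (rowStab d (gap d t)).prod
    (rowConst d (gap d t) ⊓ transposed (rowStab d (gap d (t - 1))))
  else (rowStab d (gap d (t - 1)) ⊓ transposed (rowConst d (gap d t))).prod
    (transposed (rowStab d (gap d t)))

theorem steadyGroup_odd (d : ℕ) {t : ℕ} (ht : t % 2 = 1) : steadyGroup d t =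
    (rowStab d (gap d t)).prod (rowConst d (gap d t) ⊓ transposed (rowStab d (gap d (t - 1)))) :=
  if_pos ht

theorem steadyGroup_even (d : ℕ) {t : ℕ} (ht : t % 2 = 0) : steadyGroup d t =
    (rowStab d (gap d (t - 1)) ⊓ transposed (rowConst d (gap d t))).prod
      (transposed (rowStab d (gap d t))) :=
  if_neg (by omega)

theorem finrank_steadyGroup {d : ℕ} (hd : 3 ≤ d) (hodd : d % 2 = 1) (t : ℕ) :
    Module.finrank (ZMod 2) (steadyGroup d t) + 2 = d * d := by
  rcases Nat.mod_two_eq_zero_or_one t with ht | ht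
  · rw [steadyGroup_even d ht, finrank_prod_submodule, ← finrank_transposed (_ ⊓ _),
      transposed_inf, transposed_transposed, finrank_transposed, inf_comm, add_comm (Module.finrank _ _)]
    exact finrank_rowStab hd hodd (gap_eq d _) (gap_eq d _)
  · rw [steadyGroup_odd d ht, finrank_prod_submodule]
    exact finrank_rowStab hd hodd (gap_eq d _) (gap_eq d _)

theorem steadyGroup_succ {d : ℕ} (hd : 3 ≤ d) {t : ℕ} (ht : 1 ≤ t) :
    Submodule.span (ZMod 2) ((code d).meas (t + 1)) ⊔
      (steadyGroup d t ⊓ Pauli.commutant ((code d).meas (t + 1))) = steadyGroup d (t + 1) := by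
  have hgap : gap d (t - 1) = d / 2 - 1 ∧ gap d (t + 1) = d / 2 ∨
      gap d (t - 1) = d / 2 ∧ gap d (t + 1) = d / 2 - 1 := by
    unfold gap
    rcases (by omega : t % 4 = 0 ∨ t % 4 = 1 ∨ t % 4 = 2 ∨ t % 4 = 3) with h | h | h | h
    · exact Or.inl ⟨if_neg (by omega), if_pos (by omega)⟩
    · exact Or.inl ⟨if_neg (by omega), if_pos (by omega)⟩
    · exact Or.inr ⟨if_pos (by omega), if_neg (by omega)⟩
    · exact Or.inr ⟨if_pos (by omega), if_neg (by omega)⟩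
  have key := rowEven_sup_rowStab hd (gap d t) hgap
  rcases Nat.mod_two_eq_zero_or_one t with h | h
  · have h' : (t + 1) % 2 = 1 := by omega
    rw [steadyGroup_even d h, steadyGroup_odd d h', span_odd d h', commutant_odd d h',
      Submodule.prod_inf_prod, Submodule.prod_sup_prod, inf_top_eq, bot_sup_eq, key,
      inf_comm (rowConst _ _), Nat.add_sub_cancel]
  · have h' : (t + 1) % 2 = 0 := by omega
    rw [steadyGroup_odd d h, steadyGroup_even d h', span_even d h', commutant_even d h',
      Submodule.prod_inf_prod, Submodule.prod_sup_prod, inf_top_eq, bot_sup_eq,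
      ← transposed_transposed (rowConst d (gap d t)), ← transposed_inf, ← transposed_sup,
      inf_comm (transposed _), key, Nat.add_sub_cancel]

/-- Both horizontal cuts have occurred by time 3 but only one vertical cut, so the Z factor still
has `rowEven` in place of `rowStab`. -/
theorem ISG_three {d : ℕ} (hd : 3 ≤ d) : (code d).ISG 3 = (rowStab d (d / 2 - 1)).prod
    (rowConst d (d / 2 - 1) ⊓ transposed (rowEven d (d / 2))) := by
  have h1 : gap d 1 = d / 2 := rfl
  have h2 : gap d 2 = d / 2 := rfl
  have h3 : gap d 3 = d / 2 - 1 := rfl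
  rw [DynamicalCode.ISG_succ, DynamicalCode.ISG_succ, DynamicalCode.ISG_succ,
    DynamicalCode.ISG_zero, bot_inf_eq, sup_bot_eq, span_odd d rfl, span_even d rfl,
    span_odd d rfl, commutant_even d rfl, commutant_odd d rfl]
  simp only [Nat.reduceAdd, zero_add, h1, h2, h3, Submodule.prod_inf_prod,
    Submodule.prod_sup_prod, inf_top_eq, bot_sup_eq, sup_bot_eq]
  rw [rowEven_sup_rowEven hd, inf_comm (rowConst _ _)]

theorem ISG_eq_steadyGroup {d : ℕ} (hd : 3 ≤ d) {t : ℕ} (ht : 4 ≤ t) :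
    (code d).ISG t = steadyGroup d t := by
  induction t, ht using Nat.le_induction with
  | base =>
    have h3 : gap d 3 = d / 2 - 1 := rfl
    have h4 : gap d 4 = d / 2 - 1 := rfl
    rw [DynamicalCode.ISG_succ, ISG_three hd, span_even d rfl, commutant_even d rfl,
      Submodule.prod_inf_prod, Submodule.prod_sup_prod, inf_top_eq, bot_sup_eq,
      steadyGroup_even d rfl, ← transposed_transposed (rowConst d (d / 2 - 1)), ← transposed_inf,
      ← transposed_sup, inf_comm (transposed _), h4, rowEven_sup_rowEven hd, h3]
  | succ t ht ih => rw [DynamicalCode.ISG_succ, ih, steadyGroup_succ hd (by omega)]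

theorem rank_add_two {d : ℕ} (hd : 3 ≤ d) (hodd : d % 2 = 1) {t : ℕ} (ht : 4 ≤ t) :
    (code d).rank t + 2 = d * d := by
  rw [DynamicalCode.rank, ISG_eq_steadyGroup hd ht, finrank_steadyGroup hd hodd]

/-- The pair of side rows, as a Z operator, is still missing at time 3. This makes 4 the first
steady time. -/
theorem rank_three_lt {d : ℕ} (hd : 3 ≤ d) (hodd : d % 2 = 1) :
    (code d).rank 3 + 2 < d * d := by
  rw [← finrank_steadyGroup hd hodd 3, DynamicalCode.rank, add_lt_add_iff_right]
  refine Submodule.finrank_lt_finrank_of_lt ?_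
  rw [ISG_three hd, steadyGroup_odd d rfl]
  have h2 : gap d 2 = d / 2 := rfl
  have h3 : gap d 3 = d / 2 - 1 := rfl
  rw [h3, h2, lt_iff_le_not_ge]
  refine ⟨Submodule.prod_mono le_rfl (inf_le_inf_left _ (Submodule.comap_mono le_sup_left)), ?_⟩
  intro h
  have hmem : (0, transpose d (sideColumns d)) ∈ (rowStab d (d / 2 - 1)).prod
      (rowConst d (d / 2 - 1) ⊓ transposed (rowStab d (d / 2))) :=
    ⟨zero_mem _, sideColumns_mem d _,
      Submodule.mem_sup_right (Submodule.mem_span_singleton_self _)⟩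
  have h0 := ((h hmem).2.2 ⟨0, by omega⟩).2 (by simp only; omega)
  have h1 := leftSum_sideColumns hd (Or.inl rfl : d / 2 = d / 2 ∨ _) ⟨0, by omega⟩
  exact one_ne_zero (h1.symm.trans h0)

theorem isSteady_iff {d : ℕ} (hd : 3 ≤ d) (hodd : d % 2 = 1) (t : ℕ) :
    (code d).IsSteady t ↔ 4 ≤ t := by
  constructor
  · intro h
    by_contra! ht
    have h3 := rank_three_lt hd hodd
    have h4 := rank_add_two hd hodd (le_refl 4)
    have h5 := h 4 ht
    have h6 : (code d).rank t = (code d).rank 3 := by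
      rcases Nat.lt_or_ge t 3 with h' | h'
      · exact h 3 h'
      · rw [le_antisymm (by omega : t ≤ 3) h']
    omega
  · intro ht t' ht'
    have h1 := rank_add_two hd hodd ht
    have h2 := rank_add_two hd hodd (ht.trans ht'.le)
    omega

theorem encodes {d : ℕ} (hd : 3 ≤ d) (hodd : d % 2 = 1) : (code d).Encodes 2 :=
  ⟨4, fun t ht => by rw [rank_add_two hd hodd ht, Fintype.card_prod, Fintype.card_fin]⟩

/-! ### The parent subsystem code -/

/-- An edge omitted in one half of the period is measured in the other. The gap `d` lies beyond the
grid and encodes the absence of a cut. -/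
theorem allMeas_code (d : ℕ) :
    (code d).allMeas = horizontal d d ∪ vertical d d := by
  ext P
  constructor
  · rintro ⟨t, -, hP⟩
    rw [code_meas] at hP
    rcases Nat.mod_two_eq_zero_or_one t with ht | ht
    · rw [schedule_even d ht] at hP
      obtain ⟨x, y, y', hy, -, rfl⟩ := hP
      exact Or.inr ⟨x, y, y', hy, Or.inr (by omega), rfl⟩
    · rw [schedule_odd d ht] at hP
      obtain ⟨x, x', y, hy, -, rfl⟩ := hP
      exact Or.inl ⟨x, x', y, hy, Or.inr (by omega), rfl⟩
  · rintro (⟨x, x', y, hx, -, rfl⟩ | ⟨x, y, y', hy, -, rfl⟩)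
    · by_cases h : (x : ℕ) = d / 2
      · exact ⟨3, by norm_num, x, x', y, hx, Or.inr (by omega), rfl⟩
      · exact ⟨1, le_rfl, x, x', y, hx, Or.inr h, rfl⟩
    · by_cases h : (y : ℕ) = d / 2
      · exact ⟨4, by norm_num, x, y, y', hy, Or.inr (by omega), rfl⟩
      · exact ⟨2, by norm_num, x, y, y', hy, Or.inr h, rfl⟩

theorem commutant_union {V : Type} [Fintype V] (S T : Set (Pauli V)) :
    Pauli.commutant (S ∪ T) = Pauli.commutant S ⊓ Pauli.commutant T := by
  ext P
  exact ⟨fun h => ⟨fun Q hQ => h Q (Or.inl hQ), fun Q hQ => h Q (Or.inr hQ)⟩,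
    fun h Q hQ => hQ.elim (h.1 Q) (h.2 Q)⟩

theorem mem_rowEven_full {d : ℕ} {A : Fin d × Fin d → ZMod 2} :
    A ∈ rowEven d d ↔ ∀ y, rowSum A y = 0 := by
  refine ⟨fun h y => (h y).1, fun h y => ⟨h y, fun _ => ?_⟩⟩
  rw [← h y, leftSum, rowSum]
  exact Finset.sum_congr rfl fun x _ => if_pos (by omega)

theorem encodesStatic {d : ℕ} (hd : 3 ≤ d) : (code d).EncodesStatic 1 := by
  have hspan : Submodule.span (ZMod 2) (code d).allMeas =
      (rowEven d d).prod (transposed (rowEven d d)) := by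
    rw [allMeas_code, Submodule.span_union, span_horizontal, span_vertical,
      Submodule.prod_sup_prod, sup_bot_eq, bot_sup_eq]
  have hcomm : Pauli.commutant (code d).allMeas =
      (transposed (rowConst d d)).prod (rowConst d d) := by
    rw [allMeas_code, commutant_union, commutant_horizontal, commutant_vertical,
      Submodule.prod_inf_prod, top_inf_eq, inf_top_eq]
  let z : Fin d := ⟨0, by omega⟩
  -- In the commutant, X is constant along columns and Z along rows, so one row parity and one
  -- column parity decide membership in the gauge group.
  let f : Pauli (Fin d × Fin d) →ₗ[ZMod 2] ZMod 2 × ZMod 2 :=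
    { toFun := fun P => (rowSum P.1 z, rowSum (transpose d P.2) z)
      map_add' := fun P Q => by
        rw [Prod.fst_add, Prod.snd_add, map_add, rowSum_add, rowSum_add]
        rfl
      map_smul' := fun a P => by
        rw [Prod.smul_fst, Prod.smul_snd, map_smul, rowSum_smul, rowSum_smul]
        rfl }
  have hf : ∀ P, f P = (rowSum P.1 z, rowSum (transpose d P.2) z) := fun _ => rfl
  have hfull : ∀ B ∈ rowConst d d, ∀ x x' y, B (x, y) = B (x', y) := fun B hB x x' y =>
    hB x x' y (Or.inr (by omega))
  have hker : Submodule.span (ZMod 2) (code d).allMeas ⊓ Pauli.commutant (code d).allMeas =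
      Pauli.commutant (code d).allMeas ⊓ LinearMap.ker f := by
    rw [inf_comm]
    ext P
    rw [Submodule.mem_inf, Submodule.mem_inf]
    refine and_congr_right fun hP => ?_
    rw [hcomm] at hP
    rw [hspan, LinearMap.mem_ker, hf, Prod.mk_eq_zero, Submodule.mem_prod, mem_transposed,
      mem_rowEven_full, mem_rowEven_full]
    refine and_congr ⟨fun h => h z, fun h y => ?_⟩ ⟨fun h => h z, fun h y => ?_⟩
    · rw [← h]
      exact rowSum_congr fun x => hfull _ hP.1 y z x
    · rw [← h]
      exact rowSum_congr fun x => hfull _ hP.2 y z x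
  have hsurj : ∀ p, ∃ P ∈ Pauli.commutant (code d).allMeas, f P = p := by
    rintro ⟨a, b⟩
    refine ⟨(a • column d 0, b • transpose d (column d 0)), ?_, ?_⟩
    · rw [hcomm]
      exact ⟨Submodule.smul_mem _ _ (column_mem d d 0), Submodule.smul_mem _ _ (column_mem d d 0)⟩
    · rw [hf, map_smul, transpose_transpose, rowSum_smul, rowSum_smul, rowSum_column (by omega),
        mul_one, mul_one]
  have h := finrank_inf_ker_add _ f hsurj
  rw [Module.finrank_prod, Module.finrank_self, ← hker] at h
  rw [DynamicalCode.EncodesStatic, ← h]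

end FloquetBaconShor

/-! ### Detectors and benign errors in a general dynamical code -/

namespace Pauli

variable {V : Type} [Fintype V] (P Q R : Pauli V)

theorem comm_symm : comm P Q = comm Q P := by
  rw [comm_eq_dotProduct, comm_eq_dotProduct, dotProduct_comm, dotProduct_comm P.2, add_comm]

theorem comm_add_left : comm (P + Q) R = comm P R + comm Q R := by
  simp only [comm_eq_dotProduct, Prod.fst_add, Prod.snd_add, add_dotProduct]
  ring

theorem comm_add_right : comm P (Q + R) = comm P Q + comm P R := by
  rw [comm_symm, comm_add_left, comm_symm Q, comm_symm R]

theorem comm_zero_left : comm 0 P = 0 := by simp [comm]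

theorem comm_zero_right : comm P 0 = 0 := by simp [comm]

variable {P Q}

theorem comm_eq_zero_of_mem_span {S : Set (Pauli V)} (hP : P ∈ commutant S)
    (hQ : Q ∈ Submodule.span (ZMod 2) S) : comm P Q = 0 := by
  have h : Submodule.span (ZMod 2) S ≤ commutant {P} := by
    rw [Submodule.span_le]
    rintro R hR _ rfl
    rw [comm_symm]
    exact hP R hR
  rw [comm_symm]
  exact h hQ P rfl

end Pauli

theorem Pauli.add_self_eq_zero {V : Type} (P : Pauli V) : P + P = 0 := by
  ext v <;> exact ZMod.two_add_self _

namespace DynamicalCode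

variable {V : Type} [Fintype V] {D : DynamicalCode V}

/-- An operator measured at time `s`, undisturbed from then on, and measured again after time
`s + n` gives a detector. -/
theorem Undetectable.sum_comm_eq_zero {E : SpacetimeError V} (hE : D.Undetectable E) {s n : ℕ}
    {Q : Pauli V} (hs : 1 ≤ s) (hQ : Q ∈ Submodule.span (ZMod 2) (D.meas s))
    (hc : ∀ j, j < n → Q ∈ Pauli.commutant (D.meas (s + j + 1)))
    (hend : Q ∈ Submodule.span (ZMod 2) (D.meas (s + n + 1))) :
    ∑ j ∈ Finset.range (n + 1), Pauli.comm (E (s + j)) Q = 0 := by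
  have hISG : ∀ j, j ≤ n → Q ∈ D.ISG (s + j) := by
    intro j
    induction j with
    | zero =>
      intro _
      obtain ⟨s, rfl⟩ := Nat.exists_eq_add_of_le' hs
      exact Submodule.mem_sup_left hQ
    | succ j ih => exact fun hj => Submodule.mem_sup_right ⟨ih (by omega), hc j (by omega)⟩
  -- The record starts at time `s`, where `Q` is measured from scratch, so only errors from time `s`
  -- on contribute.
  have hanc : D.IsAncestry (s + n) Q fun j => if s ≤ j then Q else 0 := by
    refine ⟨if_neg (by omega), if_pos (by omega), fun j hj => ?_⟩
    by_cases h : s ≤ j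
    · obtain ⟨i, rfl⟩ := Nat.exists_eq_add_of_le h
      simp only [if_pos h, if_pos (show s ≤ s + i + 1 by omega), sub_self]
      exact ⟨hc i (by omega), zero_mem _⟩
    · simp only [if_neg h]
      refine ⟨zero_mem _, ?_⟩
      split_ifs with h'
      · rw [show j + 1 = s by omega, sub_zero]
        exact hQ
      · rw [sub_zero]
        exact zero_mem _
  have h := hE (s + n) Q _ ⟨hend, hISG n le_rfl⟩ hanc
  rw [Triggers, add_assoc, Finset.sum_range_add, Finset.sum_eq_zero, zero_add] at h
  · simp only [Nat.le_add_right, if_true] at h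
    exact (by decide : ∀ a : ZMod 2, ¬ a = 1 → a = 0) _ h
  · intro j hj
    rw [if_neg (by simpa using hj), Pauli.comm_zero_right]

/-- A benign error has even pairing with every infinite record. -/
theorem IsBenign.sum_comm_eq_zero {E : SpacetimeError V} (hE : D.IsBenign E) {P : ℕ → Pauli V}
    (hP : ∀ j, P j ∈ Pauli.commutant (D.meas (j + 1)))
    (hP' : ∀ j, P (j + 1) - P j ∈ Submodule.span (ZMod 2) (D.meas (j + 1))) :
    (E.sum fun t Q => Pauli.comm Q (P t)) = 0 := by
  have hsucc : ∀ t, ∀ Q ∈ Pauli.commutant (D.meas (t + 1)),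
      Pauli.comm Q (P (t + 1)) = Pauli.comm Q (P t) := by
    intro t Q hQ
    have h := Pauli.comm_eq_zero_of_mem_span hQ (hP' t)
    rw [← sub_add_cancel (P (t + 1)) (P t), Pauli.comm_add_right, h, zero_add]
  have hadd : ∀ F G : SpacetimeError V, ((F + G).sum fun t Q => Pauli.comm Q (P t)) =
      (F.sum fun t Q => Pauli.comm Q (P t)) + G.sum fun t Q => Pauli.comm Q (P t) := fun F G =>
    Finsupp.sum_add_index' (fun t => Pauli.comm_zero_left _) fun t Q R => Pauli.comm_add_left _ _ _
  have hsingle : ∀ (t : ℕ) (Q : Pauli V), ((Finsupp.single t Q : SpacetimeError V).sum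
      fun t Q => Pauli.comm Q (P t)) = Pauli.comm Q (P t) := fun t Q =>
    Finsupp.sum_single_index (Pauli.comm_zero_left _)
  induction hE using Submodule.span_induction with
  | mem E h =>
    rcases h with ⟨t, m, hm, rfl⟩ | ⟨t, Q, hQ, rfl⟩
    -- Measured operators commute with one another, so the pairing with `P (t + 1)` equals that with
    -- `P t`, which commutes with the round by assumption.
    · rw [hsingle, hsucc t m fun Q hQ => D.comm_meas _ (by omega) _ hm _ hQ, Pauli.comm_symm]
      exact hP t m hm
    · rw [hadd, hsingle, hsingle, hsucc t Q hQ, ZMod.two_add_self]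
  | zero => exact Finsupp.sum_zero_index
  | add F G _ _ hF hG => rw [hadd, hF, hG, add_zero]
  | smul a F _ hF =>
    rcases (by revert a; decide : ∀ a : ZMod 2, a = 0 ∨ a = 1) a with rfl | rfl
    · rw [zero_smul]
      exact Finsupp.sum_zero_index
    · rwa [one_smul]

theorem sum_range_two_mul {M : Type} [AddCommMonoid M] (f : ℕ → M) (n : ℕ) :
    ∑ j ∈ Finset.range (2 * n), f j = ∑ k ∈ Finset.range n, (f (2 * k) + f (2 * k + 1)) := by
  induction n with
  | zero => rfl
  | succ n ih =>
    rw [Finset.sum_range_succ, ← ih, Nat.mul_succ, Finset.sum_range_succ, Finset.sum_range_succ,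
      add_assoc]

/-- An error that can be moved forward, in pairs of rounds, to times at which it is a product of
measured operators is benign. -/
theorem isBenign_of_pairs {E : SpacetimeError V} {τ N : ℕ} (h0 : ∀ t, t < τ → E t = 0)
    (hN : ∀ t, N ≤ t → E t = 0)
    (hc : ∀ k, E (τ + 2 * k) ∈ Pauli.commutant (D.meas (τ + 2 * k + 1)))
    (hs : ∀ k, E (τ + 2 * k) + E (τ + 2 * k + 1) ∈
      Submodule.span (ZMod 2) (D.meas (τ + 2 * k + 1))) : D.IsBenign E := by
  have hE : E = ∑ t ∈ Finset.range (τ + 2 * N), Finsupp.single t (E t) := by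
    conv_lhs => rw [← Finsupp.sum_single E]
    refine Finsupp.sum_of_support_subset _ (fun t ht => ?_) _ fun t _ => Finsupp.single_zero t
    rw [Finset.mem_range]
    by_contra h
    exact Finsupp.mem_support_iff.mp ht (hN t (by omega))
  rw [Finset.sum_range_add, Finset.sum_eq_zero (fun t ht => by
    rw [h0 t (Finset.mem_range.mp ht), Finsupp.single_zero]), zero_add, sum_range_two_mul] at hE
  simp only [← add_assoc] at hE
  rw [hE]
  refine Submodule.sum_mem _ fun k _ => ?_
  set P := E (τ + 2 * k)
  set Q := E (τ + 2 * k + 1)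
  have hsplit : (Finsupp.single (τ + 2 * k) P + Finsupp.single (τ + 2 * k + 1) Q :
      SpacetimeError V) = (Finsupp.single (τ + 2 * k) P + Finsupp.single (τ + 2 * k + 1) P) +
        Finsupp.single (τ + 2 * k + 1) (P + Q) := by
    rw [add_assoc (Finsupp.single _ P), ← Finsupp.single_add, ← add_assoc P, Pauli.add_self_eq_zero, zero_add]
  rw [hsplit]
  refine add_mem (Submodule.subset_span (Or.inr ⟨_, P, hc k, rfl⟩)) ?_
  have hle : Submodule.span (ZMod 2) (D.meas (τ + 2 * k + 1)) ≤ (Submodule.span (ZMod 2)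
      {F : SpacetimeError V | D.IsVacuous F ∨ D.IsSandwiching F}).comap
        (Finsupp.lsingle (τ + 2 * k + 1)) := by
    rw [Submodule.span_le]
    exact fun m hm => Submodule.subset_span (Or.inl ⟨_, m, hm, rfl⟩)
  exact hle (hs k)

end DynamicalCode

/-! ### A dynamical logical error of weight `d - 1` -/

namespace FloquetBaconShor

theorem transpose_dotProduct_eq_zero {d g : ℕ} {A B : Fin d × Fin d → ZMod 2}
    (hA : A ∈ transposed (rowConst d g)) (hB : B ∈ transposed (rowEven d g)) : A ⬝ᵥ B = 0 := by
  rw [← transpose_dotProduct, dotProduct_comm]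
  exact dotProduct_eq_zero hB hA

/-- The operator `X` on the lower parts of the two columns next to the middle column. -/
def dynamicalOperator (d : ℕ) : Pauli (Fin d × Fin d) :=
  (transpose d (leftSideRows d (d / 2 - 1)), 0)

theorem transpose_leftSideRows_ne_zero_iff {d g : ℕ} (hd : 3 ≤ d) (x y : Fin d) :
    transpose d (leftSideRows d g) (x, y) ≠ 0 ↔
      ((x : ℕ) = d / 2 - 1 ∨ (x : ℕ) = d / 2 + 1) ∧ (y : ℕ) ≤ g := by
  simp only [transpose_apply, leftSideRows, sideColumns, Pi.add_apply, column]
  split_ifs <;> simp <;> omega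

theorem weight_dynamicalOperator {d : ℕ} (hd : 3 ≤ d) (hodd : d % 2 = 1) :
    (dynamicalOperator d).weight = d - 1 := by
  have h : {v | (dynamicalOperator d).1 v ≠ 0 ∨ (dynamicalOperator d).2 v ≠ 0} =
      ((({⟨d / 2 - 1, by omega⟩, ⟨d / 2 + 1, by omega⟩} : Finset (Fin d)) ×ˢ
        Finset.Iio (⟨d / 2, by omega⟩ : Fin d) : Finset (Fin d × Fin d)) : Set (Fin d × Fin d)) := by
    ext ⟨x, y⟩
    have := transpose_leftSideRows_ne_zero_iff hd (g := d / 2 - 1) x y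
    simp only [dynamicalOperator, Set.mem_ofPred_eq, this, Pi.zero_apply, ne_eq, not_true_eq_false,
      or_false, Finset.coe_product, Set.mem_prod, Finset.mem_coe, Finset.mem_insert,
      Finset.mem_singleton, Finset.mem_Iio, Fin.ext_iff, Fin.lt_def]
    refine and_congr_right fun _ => ?_
    omega
  rw [Pauli.weight, h, Set.ncard_coe_finset, Finset.card_product, Finset.card_pair, Fin.card_Iio]
  · simp only
    omega
  · rw [ne_eq, Fin.ext_iff]
    simp only
    omega

/-- The Z part of any record at time 4 was built by rounds 2 and 4 alone. The operator is orthogonal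
to what round 4 contributes; on the contribution of round 2 it may be lengthened by two sites of the
middle row and is then orthogonal as well. -/
theorem undetectable_dynamicalOperator {d : ℕ} (hd : 3 ≤ d) :
    (code d).Undetectable (Finsupp.single 4 (dynamicalOperator d)) := by
  rintro t m P - ⟨h0, -, hP⟩ htrig
  rw [DynamicalCode.Triggers] at htrig
  by_cases ht : t < 4
  · rw [Finset.sum_eq_zero] at htrig
    · exact zero_ne_one htrig
    · intro j hj
      rw [Finset.mem_range] at hj
      rw [Finsupp.single_eq_of_ne (by omega), Pauli.comm_zero_left]
  rw [Finset.sum_eq_single 4, Finsupp.single_eq_same, Pauli.comm_eq_dotProduct] at htrig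
  · have g2 : gap d 2 = d / 2 := rfl
    have g4 : gap d 4 = d / 2 - 1 := rfl
    have e1 := (hP 0 (by omega)).2
    have e2 := (hP 1 (by omega)).2
    obtain ⟨c2, e3⟩ := hP 2 (by omega)
    have e4 := (hP 3 (by omega)).2
    rw [span_odd d rfl] at e1 e3
    rw [span_even d rfl] at e2 e4
    rw [commutant_odd d rfl] at c2
    rw [h0, sub_zero] at e1
    have b1 : (P 1).2 = 0 := e1.2
    have b3 : (P 3).2 = (P 2).2 := sub_eq_zero.mp e3.2
    have b2 : (P 2).2 ∈ transposed (rowEven d (d / 2)) := by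
      have : (P 2 - P 1).2 ∈ transposed (rowEven d (d / 2)) := e2.2
      rwa [Prod.snd_sub, b1, sub_zero] at this
    have b4 : (P 4).2 - (P 2).2 ∈ transposed (rowEven d (d / 2 - 1)) := by
      rw [← b3]
      exact e4.2
    have k4 : transpose d (leftSideRows d (d / 2 - 1)) ⬝ᵥ ((P 4).2 - (P 2).2) = 0 :=
      transpose_dotProduct_eq_zero (leftSideRows_mem hd _) b4
    have k2 : transpose d (leftSideRows d (d / 2)) ⬝ᵥ (P 2).2 = 0 :=
      transpose_dotProduct_eq_zero (leftSideRows_mem hd _) b2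
    -- The difference of the two operators is a pair of sites in the uncut middle row, hence a
    -- product of operators measured at time 3, with which the record at time 2 commutes.
    have k : (transpose d (leftSideRows d (d / 2 - 1)) + transpose d (leftSideRows d (d / 2))) ⬝ᵥ
        (P 2).2 = 0 := by
      refine dotProduct_eq_zero (fun y => ?_) c2.2
      have hr : ∀ g, rowSum (transpose d (leftSideRows d g)) y = 0 := fun g =>
        rowSum_transpose_leftSideRows hd g y
      have hl : ∀ g, leftSum (gap d 3) (transpose d (leftSideRows d g)) y =
          if (y : ℕ) ≤ g then 1 else 0 := fun g =>
        leftSum_transpose_leftSideRows hd g (gap_eq d 3) y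
      rw [rowSum_add, leftSum_add, hr, hr, hl, hl, add_zero]
      refine ⟨rfl, fun hy => ?_⟩
      have : (y : ℕ) ≤ d / 2 - 1 ↔ (y : ℕ) ≤ d / 2 := by omega
      simp only [this]
      exact ZMod.two_add_self _
    rw [add_dotProduct, k2, add_zero] at k
    rw [dotProduct_sub, k, sub_zero] at k4
    simp only [dynamicalOperator, k4, zero_dotProduct, add_zero] at htrig
    exact zero_ne_one htrig
  · intro j _ hj
    rw [Finsupp.single_eq_of_ne hj, Pauli.comm_zero_left]
  · intro h
    exact absurd (Finset.mem_range.mpr (by omega)) h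

/-- The Z operators on the left halves of the two side rows form a record without beginning or end.
When the cut moves, they change only by a pair of sites in the uncut middle column, which the
vertical round measures. -/
theorem not_isBenign_dynamicalOperator {d : ℕ} (hd : 3 ≤ d) :
    ¬ (code d).IsBenign (Finsupp.single 4 (dynamicalOperator d)) := by
  intro h
  have h' := h.sum_comm_eq_zero (P := fun j => (0, leftSideRows d (gap d (j + 1)))) (fun j => ?_)
    (fun j => ?_)
  · rw [Finsupp.sum_single_index (by rw [Pauli.comm_zero_left]), Pauli.comm_eq_dotProduct, dotProduct_zero,
      -- The two half columns and the two half rows meet in this one site.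
      add_zero, dotProduct, Finset.sum_eq_single
        ((⟨d / 2 - 1, by omega⟩, ⟨d / 2 - 1, by omega⟩) : Fin d × Fin d)] at h'
    · have g5 : gap d (4 + 1) = d / 2 := rfl
      simp only [g5, dynamicalOperator, transpose_apply, leftSideRows, sideColumns, Pi.add_apply,
        column, le_refl, if_true] at h'
      rw [if_neg (by omega), if_pos (by omega)] at h'
      exact absurd h' (by decide)
    · rintro ⟨x, y⟩ - hxy
      by_contra hne
      have h1 := (transpose_leftSideRows_ne_zero_iff hd x y).mp (left_ne_zero_of_mul hne)
      have h2 := (transpose_leftSideRows_ne_zero_iff (g := d / 2) hd y x).mp (right_ne_zero_of_mul hne)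
      refine hxy (Prod.ext (Fin.ext ?_) (Fin.ext ?_))
      · simp only
        omega
      · simp only
        omega
    · simp
  · rcases Nat.mod_two_eq_zero_or_one (j + 1) with hj | hj
    · rw [commutant_even d hj]
      exact ⟨zero_mem _, trivial⟩
    · rw [commutant_odd d hj]
      exact ⟨trivial, leftSideRows_mem hd _⟩
  · rcases Nat.mod_two_eq_zero_or_one (j + 1) with hj | hj
    · rw [span_even d hj]
      refine ⟨sub_self _, ?_⟩
      change transpose d (leftSideRows d (gap d (j + 1 + 1)) - leftSideRows d (gap d (j + 1))) ∈
        rowEven d (gap d (j + 1))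
      intro x
      rw [sub_eq_add_neg, ← neg_one_smul (ZMod 2), map_add, map_smul, rowSum_add, leftSum_add, rowSum_smul, leftSum_smul,
        rowSum_transpose_leftSideRows hd, rowSum_transpose_leftSideRows hd,
        leftSum_transpose_leftSideRows hd _ (gap_eq d _),
        leftSum_transpose_leftSideRows hd _ (gap_eq d _), mul_zero, add_zero]
      refine ⟨rfl, fun hx => ?_⟩
      have h1 := gap_eq d (j + 1 + 1)
      have h2 := gap_eq d (j + 1)
      have : (x : ℕ) ≤ gap d (j + 1 + 1) ↔ (x : ℕ) ≤ gap d (j + 1) := by omega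
      simp only [this, neg_mul, one_mul]
      exact add_neg_cancel _
    · have : gap d (j + 1 + 1) = gap d (j + 1) := by
        unfold gap
        have : (j + 1) % 4 = 1 ∨ (j + 1) % 4 = 2 ↔ (j + 1 + 1) % 4 = 1 ∨ (j + 1 + 1) % 4 = 2 := by
          omega
        simp only [this]
      simp only [this, sub_self]
      exact zero_mem _

end FloquetBaconShor

/-! ### Lower bound: block counting -/

namespace FloquetBaconShor

/-- The number of qubits on which an operator is not the identity. -/
def hamming {V : Type} [Fintype V] (A : V → ZMod 2) : ℕ := ∑ v, (A v).val

theorem hamming_add_le {V : Type} [Fintype V] (A B : V → ZMod 2) :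
    hamming (A + B) ≤ hamming A + hamming B := by
  rw [hamming, hamming, hamming, ← Finset.sum_add_distrib]
  exact Finset.sum_le_sum fun v _ => ZMod.val_add_le _ _

theorem hamming_le_weight {V : Type} [Fintype V] (P : Pauli V) {A : V → ZMod 2}
    (h : ∀ v, A v ≠ 0 → P.1 v ≠ 0 ∨ P.2 v ≠ 0) : hamming A ≤ P.weight := by
  classical
  have h1 : hamming A ≤ ∑ v, if A v ≠ 0 then 1 else 0 :=
    Finset.sum_le_sum fun v _ =>
      (by decide : ∀ a : ZMod 2, a.val ≤ if a ≠ 0 then 1 else 0) (A v)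
  refine h1.trans ?_
  rw [← Finset.card_filter, ← Set.ncard_coe_finset]
  exact Set.ncard_le_ncard (fun v hv => h v (by simpa using hv)) (Set.toFinite _)

theorem hamming_transpose {d : ℕ} (A : Fin d × Fin d → ZMod 2) :
    hamming (transpose d A) = hamming A :=
  (Equiv.prodComm (Fin d) (Fin d)).sum_comp fun v => (A v).val

theorem val_sum_le {ι : Type} (s : Finset ι) (f : ι → ZMod 2) :
    (∑ i ∈ s, f i).val ≤ ∑ i ∈ s, (f i).val :=
  Finset.le_sum_of_subadditive ZMod.val ZMod.val_zero.le ZMod.val_add_le s f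

theorem sum_row_le_hamming {d : ℕ} (g : ℕ) (A : Fin d × Fin d → ZMod 2) :
    ∑ y, ((leftSum g A y).val + (rightSum g A y).val) ≤ hamming A := by
  rw [hamming, Fintype.sum_prod_type_right]
  refine Finset.sum_le_sum fun y _ => ?_
  refine (add_le_add (val_sum_le _ _) (val_sum_le _ _)).trans ?_
  rw [← Finset.sum_add_distrib]
  refine Finset.sum_le_sum fun x _ => ?_
  by_cases hx : (x : ℕ) ≤ g
  · rw [if_pos hx, if_neg (not_lt.mpr hx)]
    simp
  · rw [if_neg hx, if_pos (not_le.mp hx)]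
    simp

/-- If all rows on the same side of the middle row look alike, then each nontrivial half row costs
half the size of the grid. -/
theorem mul_blocks_le_hamming {d : ℕ} (hodd : d % 2 = 1) {g : ℕ} {A : Fin d × Fin d → ZMod 2}
    (h : ∀ y y' : Fin d, ((y : ℕ) < d / 2 ∧ (y' : ℕ) < d / 2 ∨
      d / 2 < (y : ℕ) ∧ d / 2 < (y' : ℕ)) →
      leftSum g A y = leftSum g A y' ∧ rightSum g A y = rightSum g A y') {z w : Fin d}
    (hz : (z : ℕ) < d / 2) (hw : d / 2 < (w : ℕ)) :
    d / 2 * ((leftSum g A z).val + (rightSum g A z).val +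
      ((leftSum g A w).val + (rightSum g A w).val)) ≤ hamming A := by
  refine le_trans ?_ (sum_row_le_hamming g A)
  let m : Fin d := ⟨d / 2, by omega⟩
  have hdisj : Disjoint (Finset.Iio m) (Finset.Ioi m) := by
    rw [Finset.disjoint_left]
    intro y h1 h2
    exact lt_asymm (Finset.mem_Iio.mp h1) (Finset.mem_Ioi.mp h2)
  refine le_trans ?_ (Finset.sum_le_sum_of_subset (Finset.subset_univ
    (Finset.Iio m ∪ Finset.Ioi m)))
  rw [Finset.sum_union hdisj, mul_add]
  refine add_le_add (le_of_eq ?_) (le_of_eq ?_)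
  · rw [Finset.sum_congr rfl fun y hy => by
      rw [(h y z (Or.inl ⟨Fin.lt_def.mp (Finset.mem_Iio.mp hy), hz⟩)).1,
        (h y z (Or.inl ⟨Fin.lt_def.mp (Finset.mem_Iio.mp hy), hz⟩)).2],
      Finset.sum_const, Fin.card_Iio, smul_eq_mul]
  · rw [Finset.sum_congr rfl fun y hy => by
      rw [(h y w (Or.inr ⟨Fin.lt_def.mp (Finset.mem_Ioi.mp hy), hw⟩)).1,
        (h y w (Or.inr ⟨Fin.lt_def.mp (Finset.mem_Ioi.mp hy), hw⟩)).2],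
      Finset.sum_const, Fin.card_Ioi, smul_eq_mul]
    -- As `d` is odd, there are as many rows above the middle one as below it.
    congr 1
    simp only [m]
    omega

/-- The indicator function of a part of a row. -/
def rowPart {d : ℕ} (p : ℕ → Prop) [DecidablePred p] (y : Fin d) (v : Fin d × Fin d) : ZMod 2 :=
  if v.2 = y ∧ p v.1 then 1 else 0

section RowPart

variable {d : ℕ} (p : ℕ → Prop) [DecidablePred p] (y : Fin d)

theorem dotProduct_rowPart (A : Fin d × Fin d → ZMod 2) :
    A ⬝ᵥ rowPart p y = ∑ x : Fin d, if p x then A (x, y) else 0 := by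
  rw [dotProduct, Fintype.sum_prod_type]
  refine Finset.sum_congr rfl fun x _ => ?_
  rw [Finset.sum_eq_single y]
  · simp [rowPart]
  · intro u _ hu
    simp [rowPart, hu]
  · simp

theorem rowSum_transpose_rowPart (x : Fin d) :
    rowSum (transpose d (rowPart p y)) x = if p x then 1 else 0 := by
  rw [rowSum, Finset.sum_eq_single y]
  · simp [rowPart]
  · intro u _ hu
    simp [rowPart, hu]
  · simp

theorem leftSum_transpose_rowPart (g : ℕ) (x : Fin d) :
    leftSum g (transpose d (rowPart p y)) x = if (y : ℕ) ≤ g ∧ p x then 1 else 0 := by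
  rw [leftSum, Finset.sum_eq_single y]
  · simp [rowPart, ← ite_and]
  · intro u _ hu
    simp [rowPart, hu]
  · simp

variable {p y}

/-- Each column meets the sum in no site or in a pair of sites on the same side of the cut. -/
theorem rowPart_add_mem {y' : Fin d} {g : ℕ} (h : (y : ℕ) ≤ g ↔ (y' : ℕ) ≤ g) :
    rowPart p y + rowPart p y' ∈ transposed (rowEven d g) := by
  intro x
  change rowSum (transpose d (_ + _)) x = 0 ∧ (_ → leftSum g (transpose d (_ + _)) x = 0)
  rw [map_add, rowSum_add, leftSum_add, rowSum_transpose_rowPart, rowSum_transpose_rowPart,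
    leftSum_transpose_rowPart, leftSum_transpose_rowPart]
  simp only [h]
  exact ⟨ZMod.two_add_self _, fun _ => ZMod.two_add_self _⟩

theorem rowPart_mem {g : ℕ} (h : ∀ x x' : ℕ, ((y : ℕ) = d / 2 ∨ (x ≤ g ↔ x' ≤ g)) → (p x ↔ p x')) :
    rowPart p y ∈ rowConst d g := by
  intro x x' u hu
  by_cases huy : u = y
  · subst huy
    simp only [rowPart, h x x' hu]
  · simp [rowPart, huy]

end RowPart

/-- A light sequence of operators that satisfies the checks of one type is trivial. -/
theorem mem_rowEven_of_checks {d : ℕ} (hd : 3 ≤ d) (hodd : d % 2 = 1)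
    {a : ℕ → Fin d × Fin d → ZMod 2} {g : ℕ → ℕ} {N : ℕ} (ha0 : a 0 = 0)
    (haN : ∀ k, N ≤ k → a k = 0)
    (h1 : ∀ k, ∀ B ∈ rowConst d (g k), B ∈ transposed (rowEven d (d / 2)) →
      B ∈ transposed (rowEven d (d / 2 - 1)) → a k ⬝ᵥ B = 0)
    (h2 : ∀ k, ∀ B, (∀ j, B ∈ rowConst d (g j)) →
      B ∈ transposed (rowEven d (if k % 2 = 0 then d / 2 else d / 2 - 1)) →
      a k ⬝ᵥ B + a (k + 1) ⬝ᵥ B = 0)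
    (hw : ∑ k ∈ Finset.range (2 * N), hamming (a k) < d - 1) (k : ℕ) :
    a k ∈ rowEven d (g k) := by
  let z : Fin d := ⟨0, by omega⟩
  let w : Fin d := ⟨d - 1, by omega⟩
  let m : Fin d := ⟨d / 2, by omega⟩
  have hz : (z : ℕ) < d / 2 := by simp only [z]; omega
  have hw' : d / 2 < (w : ℕ) := by simp only [w]; omega
  have hside : ∀ k (y y' : Fin d), ((y : ℕ) < d / 2 ∧ (y' : ℕ) < d / 2 ∨
      d / 2 < (y : ℕ) ∧ d / 2 < (y' : ℕ)) → leftSum (g k) (a k) y = leftSum (g k) (a k) y' ∧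
        rightSum (g k) (a k) y = rightSum (g k) (a k) y' := by
    intro k y y' hy
    -- Two equal half rows on the same side of the middle row satisfy the evenness conditions of
    -- both vertical cuts, so they form a short check.
    have key : ∀ (p : ℕ → Prop) [DecidablePred p],
        (∀ x x', (x ≤ g k ↔ x' ≤ g k) → (p x ↔ p x')) →
        (∑ x : Fin d, if p x then a k (x, y) else 0) =
          ∑ x : Fin d, if p x then a k (x, y') else 0 := by
      intro p _ hp
      have := h1 k (rowPart p y + rowPart p y')
        (add_mem (rowPart_mem fun x x' h => hp x x' (h.resolve_left (by omega)))
          (rowPart_mem fun x x' h => hp x x' (h.resolve_left (by omega))))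
        (rowPart_add_mem (by omega)) (rowPart_add_mem (by omega))
      rw [dotProduct_add, dotProduct_rowPart, dotProduct_rowPart] at this
      exact CharTwo.add_eq_zero.mp this
    exact ⟨key (fun x => x ≤ g k) fun x x' h => h, key (fun x => g k < x) fun x x' h => by omega⟩
  -- Full rows survive every horizontal cut. The middle row lies on the side of the lower rows for
  -- the cut `d / 2`, and of the upper rows for `d / 2 - 1`, which is why the checks alternate with
  -- the parity of `k`.
  have hrow : ∀ k (y : Fin d), (k % 2 = 0 ∧ (y : ℕ) < d / 2 ∨ k % 2 = 1 ∧ d / 2 < (y : ℕ)) →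
      rowSum (a k) m + rowSum (a k) y + (rowSum (a (k + 1)) m + rowSum (a (k + 1)) y) = 0 := by
    intro k y hy
    have := h2 k (rowPart (fun _ => True) m + rowPart (fun _ => True) y)
      (fun j => add_mem (rowPart_mem fun _ _ _ => Iff.rfl) (rowPart_mem fun _ _ _ => Iff.rfl))
      (rowPart_add_mem (by simp only [m]; split_ifs <;> omega))
    simpa [dotProduct_add, dotProduct_rowPart, rowSum] using this
  have hsum : ∀ j, rowSum (a (2 * j)) m + rowSum (a (2 * j)) w =
      ∑ k ∈ Finset.range (2 * j), (rowSum (a k) z + rowSum (a k) w) := by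
    intro j
    induction j with
    | zero => simp [ha0, rowSum]
    | succ j ih =>
      rw [Nat.mul_succ, Finset.sum_range_succ, Finset.sum_range_succ, ← ih]
      have e1 := hrow (2 * j) z (Or.inl ⟨by omega, hz⟩)
      have e2 := hrow (2 * j + 1) w (Or.inr ⟨by omega, hw'⟩)
      generalize rowSum (a (2 * j)) m = x1 at *
      generalize rowSum (a (2 * j)) z = x2 at *
      generalize rowSum (a (2 * j)) w = x3 at *
      generalize rowSum (a (2 * j + 1)) m = x4 at *
      generalize rowSum (a (2 * j + 1)) z = x5 at *
      generalize rowSum (a (2 * j + 1)) w = x6 at *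
      generalize rowSum (a (2 * j + 1 + 1)) m = x7 at *
      generalize rowSum (a (2 * j + 1 + 1)) w = x8 at *
      -- The last two terms remove doubled entries, which vanish in characteristic two.
      linear_combination e2 - e1 - ZMod.two_add_self x3 - ZMod.two_add_self x6
  -- The number of nontrivial blocks among the four (left or right, below or above) at index `k`.
  set b : ℕ → ℕ := fun k => (leftSum (g k) (a k) z).val + (rightSum (g k) (a k) z).val +
    ((leftSum (g k) (a k) w).val + (rightSum (g k) (a k) w).val) with hb
  have hbcast : ∀ k, (b k : ZMod 2) = rowSum (a k) z + rowSum (a k) w := by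
    intro k
    simp only [hb, Nat.cast_add, ZMod.natCast_val, ZMod.cast_id', id_eq, leftSum_add_rightSum]
  have hle : ∑ k ∈ Finset.range (2 * N), d / 2 * b k < d - 1 :=
    (Finset.sum_le_sum fun k _ => mul_blocks_le_hamming hodd (hside k) hz hw').trans_lt hw
  have heven : ((∑ k ∈ Finset.range (2 * N), b k : ℕ) : ZMod 2) = 0 := by
    rw [Nat.cast_sum, Finset.sum_congr rfl fun k _ => hbcast k, ← hsum, haN _ (by omega)]
    simp [rowSum]
  -- Two blocks would already cost `2 * (d / 2) = d - 1` errors, and the number of blocks is even.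
  have hzero : ∑ k ∈ Finset.range (2 * N), b k = 0 := by
    rw [← Finset.mul_sum] at hle
    rw [ZMod.natCast_eq_zero_iff] at heven
    have : ∑ k ∈ Finset.range (2 * N), b k < 2 := by
      by_contra! hge
      have := Nat.mul_le_mul_left (d / 2) hge
      omega
    omega
  have hb0 : ∀ k, b k = 0 := by
    intro k
    by_cases hk : k < 2 * N
    · exact Finset.sum_eq_zero_iff.mp hzero k (Finset.mem_range.mpr hk)
    · simp [hb, haN k (by omega), leftSum, rightSum]
  have hval : ∀ k, (leftSum (g k) (a k) z = 0 ∧ rightSum (g k) (a k) z = 0) ∧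
      leftSum (g k) (a k) w = 0 ∧ rightSum (g k) (a k) w = 0 := by
    intro k
    simpa only [hb, Nat.add_eq_zero_iff, ZMod.val_eq_zero] using hb0 k
  have hLR : ∀ k (y : Fin d), (y : ℕ) ≠ d / 2 →
      leftSum (g k) (a k) y = 0 ∧ rightSum (g k) (a k) y = 0 := by
    intro k y hy
    rcases lt_or_gt_of_ne hy with h | h
    · rw [(hside k y z (Or.inl ⟨h, hz⟩)).1, (hside k y z (Or.inl ⟨h, hz⟩)).2]
      exact (hval k).1
    · rw [(hside k y w (Or.inr ⟨h, hw'⟩)).1, (hside k y w (Or.inr ⟨h, hw'⟩)).2]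
      exact (hval k).2
  have hR : ∀ k (y : Fin d), (y : ℕ) ≠ d / 2 → rowSum (a k) y = 0 := by
    intro k y hy
    rw [← leftSum_add_rightSum (g k), (hLR k y hy).1, (hLR k y hy).2, add_zero]
  -- With all other rows trivial, the long checks propagate the parity of the middle row forward
  -- from its zero initial value.
  have hm : ∀ k, rowSum (a k) m = 0 := by
    intro k
    induction k with
    | zero => simp [ha0, rowSum]
    | succ k ih =>
      rcases Nat.mod_two_eq_zero_or_one k with hk | hk
      · have := hrow k z (Or.inl ⟨hk, hz⟩)
        rwa [ih, hR _ z hz.ne, hR _ z hz.ne, zero_add, zero_add, add_zero] at this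
      · have := hrow k w (Or.inr ⟨hk, hw'⟩)
        rwa [ih, hR _ w hw'.ne', hR _ w hw'.ne', zero_add, zero_add, add_zero] at this
  intro y
  by_cases hy : (y : ℕ) = d / 2
  · rw [show y = m from Fin.ext hy]
    exact ⟨hm k, fun h => absurd rfl h⟩
  · exact ⟨hR k y hy, fun _ => (hLR k y hy).1⟩

/-! ### Lower bound: applying the counting to light undetectable errors -/

theorem sum_hamming_le_weight {d : ℕ} {E : SpacetimeError (Fin d × Fin d)}
    {F : ℕ → Fin d × Fin d → ZMod 2} {N : ℕ} (hE : ∀ t, N ≤ t → E t = 0)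
    (hF : ∀ t, hamming (F t) ≤ (E t).weight) (τ n : ℕ) :
    ∑ k ∈ Finset.range n, hamming (F (τ + 2 * k) + F (τ + 2 * k + 1)) ≤ E.weight := by
  have h0 : (0 : Pauli (Fin d × Fin d)).weight = 0 := by simp [Pauli.weight]
  have hsum : E.weight = ∑ t ∈ Finset.range (τ + 2 * n + N), (E t).weight := by
    refine Finsupp.sum_of_support_subset _ (fun t ht => ?_) _ fun t _ => h0
    rw [Finset.mem_range]
    by_contra h
    exact Finsupp.mem_support_iff.mp ht (hE t (by omega))
  rw [hsum, Finset.sum_range_add, Finset.sum_range_add, DynamicalCode.sum_range_two_mul]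
  refine le_trans (Finset.sum_le_sum fun k _ => ?_)
    ((Nat.le_add_left _ _).trans (Nat.le_add_right _ _))
  exact (hamming_add_le _ _).trans (add_le_add (hF _) (hF _))

theorem exists_bound {V : Type} (E : SpacetimeError V) : ∃ N, ∀ t, N ≤ t → E t = 0 := by
  refine ⟨E.support.sup id + 1, fun t ht => ?_⟩
  by_contra h
  have := Finset.le_sup (f := id) (Finsupp.mem_support_iff.mpr h)
  simp only [id] at this
  omega

/-- An odd round and the even round after it share their gap, and the gap alternates from one such
pair to the next. -/
theorem gap_window (d k : ℕ) :
    gap d (1 + 2 * k) = (if k % 2 = 0 then d / 2 else d / 2 - 1) ∧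
    gap d (2 + 2 * k) = (if k % 2 = 0 then d / 2 else d / 2 - 1) := by
  unfold gap
  constructor
  all_goals
    split_ifs <;> omega

/-- X errors made after a Z round commute with the next X round, so they can be pushed past it and
merged with the errors there. The merged operators obey the checks given by pure Z detectors, which
see only the X part. -/
theorem isBenign_xPart {d : ℕ} (hd : 3 ≤ d) (hodd : d % 2 = 1)
    {E E' : SpacetimeError (Fin d × Fin d)} (h0 : ∀ t, t < 4 → E t = 0)
    (hu : (code d).Undetectable E) (hw : E.weight < d - 1) (hE' : ∀ t, E' t = ((E t).1, 0)) :
    (code d).IsBenign E' := by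
  obtain ⟨N, hN⟩ := exists_bound E
  have key := mem_rowEven_of_checks hd hodd
    -- Index 0 covers times 2 and 3, before the steady stage, so the initial term vanishes.
    (a := fun k => (E (2 + 2 * k)).1 + (E (2 + 2 * k + 1)).1) (g := fun k => gap d (2 + 2 * k + 1))
    (N := N) (by simp [h0]) (fun k hk => by simp only [hN (2 + 2 * k) (by omega),
      hN (2 + 2 * k + 1) (by omega), Prod.fst_zero, add_zero]) ?_ ?_ ?_
  · refine DynamicalCode.isBenign_of_pairs (τ := 2) (N := N) (fun t ht => ?_) (fun t ht => ?_)
      (fun k => ?_) (fun k => ?_)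
    · rw [hE', h0 t (by omega)]
      rfl
    · rw [hE', hN t ht]
      rfl
    · rw [hE', commutant_odd d (by omega)]
      exact ⟨trivial, zero_mem _⟩
    · rw [hE', hE', span_odd d (by omega)]
      exact ⟨key k, add_zero _⟩
  · intro k B hB hB1 hB2
    have hgap : ∀ t, B ∈ transposed (rowEven d (gap d t)) := fun t => by
      rcases gap_eq d t with h | h <;> rwa [h]
    have := hu.sum_comm_eq_zero (s := 2 + 2 * k) (n := 1) (Q := (0, B)) (by omega)
      (by rw [span_even d (by omega)]; exact ⟨rfl, hgap _⟩)
      (fun j hj => by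
        obtain rfl : j = 0 := by omega
        rw [commutant_odd d (by omega)]
        exact ⟨trivial, hB⟩)
      (by rw [span_even d (by omega)]; exact ⟨rfl, hgap _⟩)
    simp only [Finset.sum_range_succ, Finset.sum_range_zero, zero_add, Pauli.comm_eq_dotProduct,
      dotProduct_zero, add_zero] at this
    rwa [add_dotProduct]
  · intro k B hB hB1
    have := hu.sum_comm_eq_zero (s := 2 + 2 * k) (n := 3) (Q := (0, B)) (by omega)
      (by rw [span_even d (by omega), (gap_window d k).2]; exact ⟨rfl, hB1⟩)
      (fun j hj => by
        rcases (by omega : j = 0 ∨ j = 1 ∨ j = 2) with rfl | rfl | rfl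
        · rw [commutant_odd d (by omega)]
          exact ⟨trivial, hB k⟩
        · rw [commutant_even d (by omega)]
          exact ⟨zero_mem _, trivial⟩
        · rw [commutant_odd d (by omega)]
          exact ⟨trivial, hB (k + 1)⟩)
      (by
        -- The same cut recurs four rounds later, so the operator is measured again.
        rw [span_even d (by omega), show 2 + 2 * k + 3 + 1 = 2 + 2 * (k + 2) by ring,
          (gap_window d (k + 2)).2, Nat.add_mod_right]
        exact ⟨rfl, hB1⟩)
    simp only [Finset.sum_range_succ, Finset.sum_range_zero, zero_add, Pauli.comm_eq_dotProduct,
      dotProduct_zero, add_zero] at this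
    rw [add_dotProduct, add_dotProduct, ← add_assoc]
    exact this
  · exact (sum_hamming_le_weight hN (F := fun t => (E t).1)
      (fun t => hamming_le_weight _ fun v hv => Or.inl hv) 2 _).trans_lt hw

/-- The X argument transposed. Z errors are merged between consecutive X rounds, so the pairs of
times start one round earlier, at time 1. -/
theorem isBenign_zPart {d : ℕ} (hd : 3 ≤ d) (hodd : d % 2 = 1)
    {E E' : SpacetimeError (Fin d × Fin d)} (h0 : ∀ t, t < 4 → E t = 0)
    (hu : (code d).Undetectable E) (hw : E.weight < d - 1) (hE' : ∀ t, E' t = (0, (E t).2)) :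
    (code d).IsBenign E' := by
  obtain ⟨N, hN⟩ := exists_bound E
  have hdot : ∀ t B, Pauli.comm (E t) (transpose d B, 0) = transpose d (E t).2 ⬝ᵥ B := by
    intro t B
    rw [Pauli.comm_eq_dotProduct, dotProduct_zero, zero_add, ← transpose_dotProduct,
      transpose_transpose]
  have key := mem_rowEven_of_checks hd hodd
    (a := fun k => transpose d (E (1 + 2 * k)).2 + transpose d (E (1 + 2 * k + 1)).2)
    (g := fun k => gap d (1 + 2 * k + 1))
    (N := N) (by simp [h0]) (fun k hk => by simp only [hN (1 + 2 * k) (by omega),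
      hN (1 + 2 * k + 1) (by omega), Prod.snd_zero, map_zero, add_zero]) ?_ ?_ ?_
  · refine DynamicalCode.isBenign_of_pairs (τ := 1) (N := N) (fun t ht => ?_) (fun t ht => ?_)
      (fun k => ?_) (fun k => ?_)
    · rw [hE', h0 t (by omega)]
      rfl
    · rw [hE', hN t ht]
      rfl
    · rw [hE', commutant_even d (by omega)]
      exact ⟨zero_mem _, trivial⟩
    · rw [hE', hE', span_even d (by omega)]
      exact ⟨add_zero _, key k⟩
  · intro k B hB hB1 hB2
    have hgap : ∀ t, transpose d B ∈ rowEven d (gap d t) := fun t => by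
      rcases gap_eq d t with h | h <;> rwa [h]
    have := hu.sum_comm_eq_zero (s := 1 + 2 * k) (n := 1) (Q := (transpose d B, 0)) (by omega)
      (by rw [span_odd d (by omega)]; exact ⟨hgap _, rfl⟩)
      (fun j hj => by
        obtain rfl : j = 0 := by omega
        rw [commutant_even d (by omega)]
        exact ⟨hB, trivial⟩)
      (by rw [span_odd d (by omega)]; exact ⟨hgap _, rfl⟩)
    simp only [Finset.sum_range_succ, Finset.sum_range_zero, zero_add, hdot, add_zero] at this
    rwa [add_dotProduct]
  · intro k B hB hB1
    have := hu.sum_comm_eq_zero (s := 1 + 2 * k) (n := 3) (Q := (transpose d B, 0)) (by omega)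
      (by rw [span_odd d (by omega), (gap_window d k).1]; exact ⟨hB1, rfl⟩)
      (fun j hj => by
        rcases (by omega : j = 0 ∨ j = 1 ∨ j = 2) with rfl | rfl | rfl
        · rw [commutant_even d (by omega)]
          exact ⟨hB k, trivial⟩
        · rw [commutant_odd d (by omega)]
          exact ⟨trivial, zero_mem _⟩
        · rw [commutant_even d (by omega)]
          exact ⟨hB (k + 1), trivial⟩)
      (by
        rw [span_odd d (by omega), show 1 + 2 * k + 3 + 1 = 1 + 2 * (k + 2) by ring,
          (gap_window d (k + 2)).1, Nat.add_mod_right]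
        exact ⟨hB1, rfl⟩)
    simp only [Finset.sum_range_succ, Finset.sum_range_zero, zero_add, hdot, add_zero] at this
    rw [add_dotProduct, add_dotProduct, ← add_assoc]
    exact this
  · refine (sum_hamming_le_weight hN (F := fun t => transpose d (E t).2) (fun t => ?_) 1 _).trans_lt hw
    rw [hamming_transpose]
    exact hamming_le_weight _ fun v hv => Or.inr hv

theorem hasDistance {d : ℕ} (hd : 3 ≤ d) (hodd : d % 2 = 1) : (code d).HasDistance (d - 1) := by
  constructor
  · refine ⟨Finsupp.single 4 (dynamicalOperator d), ⟨4, (isSteady_iff hd hodd 4).mpr le_rfl,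
      fun t ht => Finsupp.single_eq_of_ne (by omega)⟩, undetectable_dynamicalOperator hd,
      not_isBenign_dynamicalOperator hd, ?_⟩
    rw [SpacetimeError.weight, Finsupp.sum_single_index (by simp [Pauli.weight]),
      weight_dynamicalOperator hd hodd]
  · rintro _ ⟨E, ⟨t₀, ht₀, hE⟩, hu, hb, rfl⟩
    rw [isSteady_iff hd hodd] at ht₀
    by_contra! hw
    have h0 : ∀ t, t < 4 → E t = 0 := fun t ht => hE t (by omega)
    refine hb ?_
    have hsplit : E = E.mapRange (fun P => (P.1, 0)) rfl + E.mapRange (fun P => (0, P.2)) rfl := by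
      ext t v <;> simp
    rw [hsplit]
    exact add_mem (isBenign_xPart hd hodd h0 hu hw fun t => Finsupp.mapRange_apply)
      (isBenign_zPart hd hodd h0 hu hw fun t => Finsupp.mapRange_apply)

end FloquetBaconShor

theorem mainTheorem6 (d : ℕ) (hodd : Odd d) (hd : 3 ≤ d) :
    (FloquetBaconShor.code d).EncodesStaticDynamical 1 1 ∧
      (FloquetBaconShor.code d).HasDistance (d - 1) := by
  have h := Nat.odd_iff.mp hodd
  exact ⟨⟨FloquetBaconShor.encodesStatic hd, FloquetBaconShor.encodes hd h⟩,
    FloquetBaconShor.hasDistance hd h⟩
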